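/- Let $N\in\mathbb N$, $a<b$ real, $J=[a,b]$ (oriented from $a$ to $b$), and let $\boldsymbol E_L=(f_1,\dots,f_N)^{T}$, $\boldsymbol E_R=(e_1,\dots,e_N)^{T}$ be smooth $\mathbb C^N$-valued functions on $J$ with $\sum_{m} f_m(\lambda)e_m(\lambda)=0$ for all $\lambda\in J$. Let $\chi$ be a solution of the following $N\times N$ matrix Riemann--Hilbert problem: $\chi$ is holomorphic on $\mathbb C\setminus J$; it has continuous boundary values $\chi_+$ (from above) and $\chi_-$ (from below) on $(a,b)$, with $$\chi_-(\lambda)=\chi_+(\lambda)\bigl(I_N+2i\pi\,\boldsymbol E_R(\lambda)\boldsymbol E_L(\lambda)^{T}\bigr),\qquad \lambda\in(a,b);$$ the entries of $\chi(z)$ are $O(\ln|z-p|)$ as $z\to p$ for $p\in\{a,b\}$; and $\chi(z)=I_N+O(z^{-1})$ as $z\to\infty$. Let $c_1,\dots,c_N\in\mathbb R\setminus\{0\}$, $\gamma_1,\dots,\gamma_N\in\mathbb C$ and $v_1,\dots,v_N\in\{1,\dots,N\}$, and let $\boldsymbol e_1,\dots,\boldsymbol e_N$ be the canonical basis of $\mathbb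 C^N$, with $(x,y)=\sum_m x_my_m$. Let $\Gamma(J)$ be a closed piecewise $C^1$ curve in $\{z\in\mathbb C\setminus J: |\operatorname{Im} z|<|c_k|/2 \text{ for all } k\}$ having index $1$ around every point of $J$. Consider the matrix integral operator $\mathcal M$ on $L^2(\Gamma(J))\otimes\mathbb C^N$ with entries $$\mathcal M_{k\ell}(\lambda,\mu)=\gamma_k\,\frac{\bigl(\boldsymbol e_{v_k},\chi^{-1}(\lambda)\chi(\mu-ic_\ell)\boldsymbol e_\ell\bigr)}{2i\pi(\lambda-\mu+ic_\ell)},$$ and the matrix integral operator $\mathcal N$ on $L^2(\mathbb R)\otimes\mathbb C^N$ with entries $$\mathcal N_{k\ell}(\lambda,\mu)=\operatorname{sgn}(c_k)\,\gamma_k\,\frac{\bigl(\boldsymbol e_{v_k},[I_N-\chi^{-1}(\lambda+ic_k/2)\chi(\mu-ic_\ell/2)]\boldsymbol e_\ell\bigr)}{2i\pi\bigl(\lambda-\mu+i(c_k+c_\ell)/2\bigr)},$$ the quotient being given its limit value at $\lambda=\mu$ when $c_k+c_\ell=0$. Then the kernels $\mathcal N_{k\ell}$ are continuous on $\mathbb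 R^2$; both kernels are square integrable (for $\mathcal M$, after parametrising $\Gamma(J)$ by $[0,1]$ and absorbing the derivative of the parametrisation, in the variable $\mu$, into the kernel); their Fredholm series consist of convergent integrals and converge absolutely; and the Fredholm determinants, defined by these series, satisfy $$\det_{\Gamma(J)}[I+\mathcal M]=\det_{\mathbb R}[I+\mathcal N].$$ -/

import Mathlib

open Set Filter Topology MeasureTheory Complex
open scoped ContDiff Nat

noncomputable section

/-- The real interval `[a, b]`, seen as a subset of the complex plane. -/
def cutSet (a b : ℝ) : Set ℂ := (fun t : ℝ => (t : ℂ)) '' Icc a b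

/-- `χ` solves the matrix Riemann--Hilbert problem on `J = [a, b]` (oriented from `a` to `b`, so
that the `+` side is the upper side) with jump matrix `I + 2πi E_R E_Lᵀ`. -/
structure IsRHPSolution {N : ℕ} (a b : ℝ) (EL ER : ℝ → Fin N → ℂ)
    (χ : ℂ → Matrix (Fin N) (Fin N) ℂ) : Prop where
  /-- `χ` is holomorphic off `J`. -/
  holomorphic : ∀ i j, DifferentiableOn ℂ (fun z => χ z i j) (cutSet a b)ᶜ
  /-- `χ` has continuous boundary values on the interior of `J` and
  `χ₋ = χ₊ (I + 2πi E_R E_Lᵀ)` there. -/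
  jump : ∃ χp χm : ℝ → Matrix (Fin N) (Fin N) ℂ,
    ContinuousOn χp (Ioo a b) ∧ ContinuousOn χm (Ioo a b) ∧
    ∀ s ∈ Ioo a b,
      Tendsto χ (𝓝[{z : ℂ | 0 < z.im}] (s : ℂ)) (𝓝 (χp s)) ∧
      Tendsto χ (𝓝[{z : ℂ | z.im < 0}] (s : ℂ)) (𝓝 (χm s)) ∧
      χm s = χp s * (1 + (2 * (Real.pi : ℂ) * I) • Matrix.vecMulVec (ER s) (EL s))
  /-- At worst logarithmic singularities at the two end points. -/
  endpoints : ∀ p : ℝ, p = a ∨ p = b → ∀ i j,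
    (fun z => χ z i j) =O[𝓝[(cutSet a b)ᶜ] (p : ℂ)] fun z => Real.log ‖z - (p : ℂ)‖
  /-- `χ(z) = I + O(1/z)` at infinity. -/
  infinity : ∀ i j,
    (fun z => χ z i j - (1 : Matrix (Fin N) (Fin N) ℂ) i j)
      =O[Bornology.cobounded ℂ] fun z => z⁻¹

/-- A piecewise `C¹` curve parametrised by `[0, 1]`: it is continuous, and `C¹` (up to the end
points) on every closed subinterval whose interior misses a fixed finite set. -/
def IsPiecewiseC1 (Γ : ℝ → ℂ) : Prop :=
  ContinuousOn Γ (Icc 0 1) ∧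
  ∃ P : Finset ℝ, ∀ x y : ℝ, x < y → Icc x y ⊆ Icc (0 : ℝ) 1 →
    Disjoint (Ioo x y) (P : Set ℝ) → ContDiffOn ℝ 1 Γ (Icc x y)

/-- A closed piecewise `C¹` curve avoiding `[a, b]` and having index `1` around each of
its points. -/
structure IsLoopAround (a b : ℝ) (Γ : ℝ → ℂ) : Prop where
  piecewiseC1 : IsPiecewiseC1 Γ
  closed : Γ 0 = Γ 1
  avoids : ∀ t ∈ Icc (0 : ℝ) 1, Γ t ∉ cutSet a b
  index_one : ∀ s ∈ Icc a b,
    (1 / (2 * (Real.pi : ℂ) * I)) * (∫ t in (0 : ℝ)..1, deriv Γ t / (Γ t - (s : ℂ))) = 1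

section Fredholm

variable {ι X : Type*} [Fintype ι] [MeasurableSpace X]

/-- The integrand `det [K_{κ i, κ j}(x_i, x_j)]_{1 ≤ i, j ≤ n}` of the Fredholm series. -/
def fredholmIntegrand (K : ι → ι → X → X → ℂ) (n : ℕ) (κ : Fin n → ι) (x : Fin n → X) : ℂ :=
  (Matrix.of fun i j : Fin n => K (κ i) (κ j) (x i) (x j)).det

/-- The `n`-th term of the Fredholm series of `det [I + K]`, for the matrix integral operator
`(K f)_k (x) = ∑_ℓ ∫ K_{kℓ}(x, y) f_ℓ(y) dμ(y)` on `L²(μ) ⊗ ℂ^ι`. -/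
def fredholmTerm (μ : Measure X) (K : ι → ι → X → X → ℂ) (n : ℕ) : ℂ :=
  (1 / (n ! : ℂ)) *
    ∑ κ : Fin n → ι, ∫ x : Fin n → X, fredholmIntegrand K n κ x ∂(Measure.pi fun _ => μ)

/-- The Fredholm determinant `det [I + K]`. -/
def fredholmDet (μ : Measure X) (K : ι → ι → X → X → ℂ) : ℂ := ∑' n, fredholmTerm μ K n

/-- `K` is the kernel of a (Hilbert--Schmidt) matrix integral operator on `L²(μ) ⊗ ℂ^ι`, whose
Fredholm series is made of convergent integrals and converges absolutely. -/
structure HasFredholmDet (μ : Measure X) (K : ι → ι → X → X → ℂ) : Prop where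
  memLp : ∀ k l, MemLp (fun p : X × X => K k l p.1 p.2) 2 (μ.prod μ)
  integrable : ∀ (n : ℕ) (κ : Fin n → ι),
    Integrable (fredholmIntegrand K n κ) (Measure.pi fun _ => μ)
  summable : Summable (fredholmTerm μ K)

end Fredholm

section Kernels

variable {N : ℕ}

/-- The kernel `M_{kℓ}(λ, μ)` on the loop. -/
def kernelM (χ : ℂ → Matrix (Fin N) (Fin N) ℂ) (c : Fin N → ℝ) (γ : Fin N → ℂ)
    (v : Fin N → Fin N) (k l : Fin N) (z w : ℂ) : ℂ :=
  γ k * ((χ z)⁻¹ * χ (w - I * (c l : ℂ))) (v k) l /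
    (2 * I * (Real.pi : ℂ) * (z - w + I * (c l : ℂ)))

/-- A kernel on the curve `Γ`, written in the parameter: `∫_Γ K(z, w) f(w) dw` is
`∫₀¹ K(Γ s, Γ t) Γ'(t) f(Γ t) dt`. -/
def pullbackKernel {ι : Type*} (Γ : ℝ → ℂ) (K : ι → ι → ℂ → ℂ → ℂ) (k l : ι) (s t : ℝ) : ℂ :=
  K k l (Γ s) (Γ t) * deriv Γ t

/-- The kernel `N_{kℓ}(x, y)` on the real line. If `c_k + c_ℓ = 0` and `x = y`, the quotient
`[I - χ⁻¹(z) χ(w)] / (z - w)` at `z = w` is given its limit value `χ⁻¹(z) χ'(z)`. -/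
def kernelN (χ : ℂ → Matrix (Fin N) (Fin N) ℂ) (c : Fin N → ℝ) (γ : Fin N → ℂ)
    (v : Fin N → Fin N) (k l : Fin N) (x y : ℝ) : ℂ :=
  if (x : ℂ) - y + I * ((c k : ℂ) + c l) / 2 = 0 then
    (Real.sign (c k) : ℂ) * γ k *
      ((χ (x + I * (c k : ℂ) / 2))⁻¹ *
        Matrix.of fun i j => deriv (fun z => χ z i j) (x + I * (c k : ℂ) / 2)) (v k) l /
      (2 * I * (Real.pi : ℂ))
  else
    (Real.sign (c k) : ℂ) * γ k *
      (1 - (χ (x + I * (c k : ℂ) / 2))⁻¹ * χ (y - I * (c l : ℂ) / 2)) (v k) l /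
      (2 * I * (Real.pi : ℂ) * ((x : ℂ) - y + I * ((c k : ℂ) + c l) / 2))

end Kernels

end

/-! The two operators are the two products of one pair of factors. Let `factorA` be the kernel of A
: L²(ℝ) → L²(Γ), made of χ⁻¹ on the loop, χ on the lines Im = -c_ℓ/2 and a Cauchy kernel. Let
`factorB` be the kernel of B : L²(Γ) → L²(ℝ), a Cauchy kernel diagonal in the matrix index. Then M =
AB and N = BA, and det(I + AB) = det(I + BA) holds term by term in the Fredholm series
(`KernelFactors.fredholmTerm_kernelAB_eq`): expand by Leibniz, apply Fubini, relabel the variables.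
Hadamard's inequality gives absolute convergence for AB, whose kernel is bounded on a finite measure
space; BA inherits it.

Both factorisations are residue computations. In AB (`LoopData.kernelAB_eq`) the line Im = -c_ℓ/2
separates Γ(t) - ic_ℓ from Γ(s) and the cut, so only the first pole contributes. In BA
(`LoopData.kernelBA_of_ne`) the loop integral is evaluated from outside, at z = x + ic_k/2 and w = y
- ic_ℓ/2; the pole at w gives χ⁻¹(w)χ(w) = I and the one at z gives χ⁻¹(z)χ(w). The removable
diagonal follows by continuity (`LoopData.kernelBA_eq`).

The inverse χ⁻¹ is under control because the jump matrix has determinant 1, which forces det χ = 1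
(`IsRHPSolution.det_eq_one`). The integrals are evaluated by primitives: once the poles at p and at
a ∈ J are subtracted, F(z)/(z - p) is O(z⁻²) and has a primitive off J, since 1/(z - a) maps the
exterior of J to a star-shaped domain (`exists_primitive_dslope_sub`); the subtracted terms are
integrated by logarithms and by the index. -/

noncomputable section

/-! ### Hadamard's bound and the growth of Fredholm terms. -/

open scoped ComplexOrder in
/-- A form of Hadamard's determinant inequality. -/
theorem Matrix.norm_det_le_of_norm_entry_le {n : ℕ} (M : Matrix (Fin n) (Fin n) ℂ) {C : ℝ}
    (hC : ∀ i j, ‖M i j‖ ≤ C) : ‖M.det‖ ≤ (√n * C) ^ n := by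
  rcases Nat.eq_zero_or_pos n with rfl | hn
  · simp
  have hC0 : 0 ≤ C := (norm_nonneg _).trans (hC ⟨0, hn⟩ ⟨0, hn⟩)
  -- Arithmetic-geometric mean inequality for the eigenvalues of M M*: their product is |det M|²,
  -- their sum the squared Frobenius norm, at most n²C².
  have hpsd : (M * M.conjTranspose).PosSemidef := Matrix.posSemidef_self_mul_conjTranspose M
  have hdet : ∏ i, hpsd.1.eigenvalues i = ‖M.det‖ ^ 2 := by
    have h := hpsd.1.det_eq_prod_eigenvalues
    rw [Matrix.det_mul, Matrix.det_conjTranspose] at h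
    have h2 : M.det * star M.det = ((‖M.det‖ ^ 2 : ℝ) : ℂ) := by
      rw [Complex.star_def, Complex.mul_conj, Complex.normSq_eq_norm_sq]
    rw [h2] at h
    have h3 := h.symm
    simp only [Complex.coe_algebraMap] at h3
    exact_mod_cast h3
  have htr : ∑ i, hpsd.1.eigenvalues i ≤ (n : ℝ) * (n * C ^ 2) := by
    have h := hpsd.1.trace_eq_sum_eigenvalues
    have h2 : (M * M.conjTranspose).trace = ((∑ i, ∑ j, ‖M i j‖ ^ 2 : ℝ) : ℂ) := by
      push_cast
      simp only [Matrix.trace, Matrix.diag, Matrix.mul_apply, Matrix.conjTranspose_apply]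
      refine Finset.sum_congr rfl fun i _ => Finset.sum_congr rfl fun j _ => ?_
      rw [Complex.star_def, Complex.mul_conj, Complex.normSq_eq_norm_sq]
      push_cast; rfl
    rw [h2] at h
    have h3 : (∑ i, ∑ j, ‖M i j‖ ^ 2 : ℝ) = ∑ i, hpsd.1.eigenvalues i := by
      apply Complex.ofReal_injective
      rw [h]; simp
    rw [← h3]
    calc _ ≤ ∑ _i : Fin n, ∑ _j : Fin n, C ^ 2 := by
          gcongr with i _ j _; exact hC i j
      _ = _ := by simp
  have hn0 : (0 : ℝ) < n := by exact_mod_cast hn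
  have hamgm := Real.geom_mean_le_arith_mean Finset.univ (fun _ : Fin n => (1 : ℝ))
    hpsd.1.eigenvalues (by simp) (by simpa using hn) (fun i _ => hpsd.eigenvalues_nonneg i)
  simp only [Real.rpow_one, hdet, one_mul, Finset.sum_const, Finset.card_univ, Fintype.card_fin,
    nsmul_eq_mul, mul_one] at hamgm
  have h1 : ‖M.det‖ ^ 2 ≤ ((n : ℝ) * C ^ 2) ^ n := by
    have h2 : (‖M.det‖ ^ 2) ^ (n : ℝ)⁻¹ ≤ n * C ^ 2 := by
      refine hamgm.trans ?_
      rw [div_le_iff₀ hn0]; linarith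
    calc ‖M.det‖ ^ 2 = ((‖M.det‖ ^ 2) ^ (n : ℝ)⁻¹) ^ n :=
          (Real.rpow_inv_natCast_pow (by positivity) hn.ne').symm
      _ ≤ _ := by gcongr
  refine le_of_sq_le_sq ?_ (by positivity)
  calc _ ≤ _ := h1
    _ = _ := by
      rw [← pow_mul, mul_comm n 2, pow_mul, mul_pow (√(n : ℝ)), Real.sq_sqrt hn0.le]

/-- Since nⁿ ≤ n! eⁿ, the square of 2ⁿ times the term is at most (4eK²)ⁿ/n!. Writing the term as 2⁻ⁿ
times that quantity and using pq ≤ p² + q² bounds it by 4⁻ⁿ + (4eK²)ⁿ/n!. -/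
theorem summable_sqrt_mul_pow_div_factorial (K : ℝ) :
    Summable fun n : ℕ => (√n * K) ^ n / (n ! : ℝ) := by
  have h1 : Summable fun n : ℕ => (1 / 4 : ℝ) ^ n :=
    summable_geometric_of_lt_one (by norm_num) (by norm_num)
  have h2 := Real.summable_pow_div_factorial (4 * Real.exp 1 * K ^ 2)
  refine Summable.of_norm_bounded (h1.add h2) fun n => ?_
  have hf : (0 : ℝ) < n ! := by exact_mod_cast Nat.factorial_pos n
  have he : (n : ℝ) ^ n ≤ n ! * Real.exp 1 ^ n := by
    have := Real.pow_div_factorial_le_exp (n : ℝ) (by positivity) n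
    rw [div_le_iff₀ hf] at this
    rw [← Real.exp_nat_mul, mul_one]; linarith
  have hx : ‖(√n * K) ^ n / (n ! : ℝ)‖ = |(√n * K) ^ n| / n ! := by
    rw [norm_div, Real.norm_eq_abs, Real.norm_of_nonneg hf.le]
  rw [hx]
  set x := |(√n * K) ^ n|
  have hx2 : x ^ 2 = (n : ℝ) ^ n * (K ^ 2) ^ n := by
    rw [sq_abs, ← pow_mul, mul_comm n 2, pow_mul, mul_pow, Real.sq_sqrt (by positivity), mul_pow]
  have hy : (2 ^ n * x / n !) ^ 2 ≤ (4 * Real.exp 1 * K ^ 2) ^ n / n ! := by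
    rw [div_pow, mul_pow, hx2, div_le_div_iff₀ (by positivity) hf, mul_pow, mul_pow, ← pow_mul,
      mul_comm n 2, pow_mul]
    rw [show (2 : ℝ) ^ 2 = 4 by norm_num]
    have : (0 : ℝ) ≤ 4 ^ n * (K ^ 2) ^ n * n ! := by positivity
    nlinarith [mul_le_mul_of_nonneg_left he this]
  have hz : x / n ! = (1 / 2) ^ n * (2 ^ n * x / n !) := by
    rw [← mul_div_assoc, ← mul_assoc, ← mul_pow]; norm_num
  have hq : ((1 / 2 : ℝ) ^ n) ^ 2 = (1 / 4) ^ n := by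
    rw [← pow_mul, mul_comm, pow_mul]; norm_num
  rw [hz]
  nlinarith [sq_nonneg ((1 / 2 : ℝ) ^ n - 2 ^ n * x / n !), sq_nonneg ((1 / 2 : ℝ) ^ n),
    sq_nonneg (2 ^ n * x / n !)]

/-! ### Fredholm determinants of AB and BA. -/

section FredholmSwap

set_option linter.unusedSectionVars false

variable {ι X Y : Type*} [Fintype ι] [MeasurableSpace X] [MeasurableSpace Y]

theorem fredholmIntegrand_eq_sum (K : ι → ι → X → X → ℂ) (n : ℕ) (κ : Fin n → ι) (x : Fin n → X) :
    fredholmIntegrand K n κ x = ∑ σ : Equiv.Perm (Fin n),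
      Equiv.Perm.sign σ • ∏ i, K (κ (σ i)) (κ i) (x (σ i)) (x i) := by
  simp [fredholmIntegrand, Matrix.det_apply]

theorem MeasureTheory.integral_comp_perm (μ : Measure X) [SigmaFinite μ] {n : ℕ}
    (σ : Equiv.Perm (Fin n)) (f : (Fin n → X) → ℂ) :
    ∫ x, f (x ∘ σ) ∂(Measure.pi fun _ => μ) = ∫ x, f x ∂(Measure.pi fun _ => μ) := by
  have h := measurePreserving_piCongrLeft (fun _ : Fin n => μ) σ.symm
  refine Eq.trans ?_ (h.integral_comp' f)
  congr 1
  ext x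
  congr 1
  ext i
  have := MeasurableEquiv.piCongrLeft_apply_apply (β := fun _ : Fin n => X) σ.symm x (σ i)
  simpa using this.symm

/-- Data for a factorisation `M = A B`, `N = B A` with `B` diagonal in the matrix indices. -/
structure KernelFactors (μ : Measure X) (ν : Measure Y) (A : ι → ι → X → Y → ℂ)
    (B : ι → Y → X → ℂ) (g : Y → ℝ) : Prop where
  measurable_left : ∀ k l, StronglyMeasurable fun p : X × Y => A k l p.1 p.2
  measurable_right : ∀ k, StronglyMeasurable fun p : Y × X => B k p.1 p.2
  norm_left_le : ∀ k l x y, ‖A k l x y‖ ≤ g y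
  norm_right_le : ∀ k y x, ‖B k y x‖ ≤ g y
  integrable_sq : Integrable (fun y => g y ^ 2) ν

/-- The kernel of `A B`. -/
def kernelAB (ν : Measure Y) (A : ι → ι → X → Y → ℂ) (B : ι → Y → X → ℂ) (k l : ι) (x x' : X) : ℂ :=
  ∫ y, A k l x y * B l y x' ∂ν

/-- The kernel of `B A`. -/
def kernelBA (μ : Measure X) (A : ι → ι → X → Y → ℂ) (B : ι → Y → X → ℂ) (k l : ι) (y y' : Y) : ℂ :=
  ∫ x, B k y x * A k l x y' ∂μ

namespace KernelFactors

variable {μ : Measure X} [IsFiniteMeasure μ] {ν : Measure Y} [SigmaFinite ν]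
  {A : ι → ι → X → Y → ℂ} {B : ι → Y → X → ℂ} {g : Y → ℝ}

theorem stronglyMeasurable_kernelAB (h : KernelFactors μ ν A B g) (k l : ι) :
    StronglyMeasurable fun p : X × X => kernelAB ν A B k l p.1 p.2 := by
  refine StronglyMeasurable.integral_prod_right (f := fun (p : X × X) (y : Y) =>
    A k l p.1 y * B l y p.2) ?_
  exact ((h.measurable_left k l).comp_measurable (g := fun q : (X × X) × Y => (q.1.1, q.2))
    (by fun_prop)).mul ((h.measurable_right l).comp_measurable
      (g := fun q : (X × X) × Y => (q.2, q.1.2)) (by fun_prop))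

theorem stronglyMeasurable_kernelBA (h : KernelFactors μ ν A B g) (k l : ι) :
    StronglyMeasurable fun p : Y × Y => kernelBA μ A B k l p.1 p.2 := by
  refine StronglyMeasurable.integral_prod_right (f := fun (p : Y × Y) (x : X) =>
    B k p.1 x * A k l x p.2) ?_
  exact ((h.measurable_right k).comp_measurable (g := fun q : (Y × Y) × X => (q.1.1, q.2))
    (by fun_prop)).mul ((h.measurable_left k l).comp_measurable
      (g := fun q : (Y × Y) × X => (q.2, q.1.2)) (by fun_prop))

theorem norm_kernelAB_le (h : KernelFactors μ ν A B g) (k l : ι) (x x' : X) :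
    ‖kernelAB ν A B k l x x'‖ ≤ ∫ y, g y ^ 2 ∂ν := by
  refine norm_integral_le_of_norm_le h.integrable_sq (.of_forall fun y => ?_)
  rw [norm_mul, sq]
  have h1 := h.norm_left_le k l x y
  exact mul_le_mul h1 (h.norm_right_le l y x') (norm_nonneg _) ((norm_nonneg _).trans h1)

theorem norm_kernelBA_le (h : KernelFactors μ ν A B g) (k l : ι) (y y' : Y) :
    ‖kernelBA μ A B k l y y'‖ ≤ g y * g y' * μ.real univ := by
  refine norm_integral_le_of_norm_le_const (.of_forall fun x => ?_)
  rw [norm_mul]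
  have h1 := h.norm_right_le k y x
  exact mul_le_mul h1 (h.norm_left_le k l x y') (norm_nonneg _) ((norm_nonneg _).trans h1)

/-- The product over which both Fredholm series are expanded. -/
def cycleProd (A : ι → ι → X → Y → ℂ) (B : ι → Y → X → ℂ) {n : ℕ} (κ : Fin n → ι)
    (σ : Equiv.Perm (Fin n)) (x : Fin n → X) (y : Fin n → Y) : ℂ :=
  ∏ i, A (κ (σ i)) (κ i) (x (σ i)) (y i) * B (κ i) (y i) (x i)

/-- Each y_i occurs in exactly one A and one B, so ∏ g(y_i)² dominates, uniformly in x; μ is finite.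
This licenses Fubini. -/
theorem integrable_cycleProd (h : KernelFactors μ ν A B g) {n : ℕ} (κ : Fin n → ι)
    (σ : Equiv.Perm (Fin n)) :
    Integrable (fun p : (Fin n → X) × (Fin n → Y) => cycleProd A B κ σ p.1 p.2)
      ((Measure.pi fun _ => μ).prod (Measure.pi fun _ => ν)) := by
  have hg : Integrable (fun p : (Fin n → X) × (Fin n → Y) => (1 : ℝ) * ∏ i, g (p.2 i) ^ 2)
      ((Measure.pi fun _ => μ).prod (Measure.pi fun _ => ν)) :=
    (integrable_const (1 : ℝ)).mul_prod (f := fun _ : Fin n → X => (1 : ℝ))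
      (Integrable.fintype_prod (f := fun (_ : Fin n) y => g y ^ 2) fun _ => h.integrable_sq)
  refine hg.mono' ?_ (.of_forall fun p => ?_)
  · refine StronglyMeasurable.aestronglyMeasurable ?_
    refine Finset.stronglyMeasurable_fun_prod _ fun i _ => ?_
    exact ((h.measurable_left _ _).comp_measurable
      (g := fun p : (Fin n → X) × (Fin n → Y) => (p.1 (σ i), p.2 i)) (by fun_prop)).mul
      ((h.measurable_right _).comp_measurable
      (g := fun p : (Fin n → X) × (Fin n → Y) => (p.2 i, p.1 i)) (by fun_prop))
  · rw [cycleProd, norm_prod, one_mul]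
    refine Finset.prod_le_prod (fun i _ => norm_nonneg _) fun i _ => ?_
    rw [norm_mul, sq]
    have h1 := h.norm_left_le (κ (σ i)) (κ i) (p.1 (σ i)) (p.2 i)
    exact mul_le_mul h1 (h.norm_right_le _ _ _) (norm_nonneg _) ((norm_nonneg _).trans h1)

theorem fredholmIntegrand_kernelAB (n : ℕ) (κ : Fin n → ι) (x : Fin n → X) :
    fredholmIntegrand (kernelAB ν A B) n κ x = ∑ σ : Equiv.Perm (Fin n),
      Equiv.Perm.sign σ • ∫ y, cycleProd A B κ σ x y ∂(Measure.pi fun _ => ν) := by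
  rw [fredholmIntegrand_eq_sum]
  refine Finset.sum_congr rfl fun σ _ => ?_
  congr 1
  exact (integral_fintype_prod_eq_prod (𝕜 := ℂ) (fun i y =>
    A (κ (σ i)) (κ i) (x (σ i)) y * B (κ i) y (x i))).symm

theorem fredholmIntegrand_kernelBA (n : ℕ) (κ : Fin n → ι) (y : Fin n → Y) :
    fredholmIntegrand (kernelBA μ A B) n κ y = ∑ σ : Equiv.Perm (Fin n),
      Equiv.Perm.sign σ • ∫ x, cycleProd A B κ σ x y ∂(Measure.pi fun _ => μ) := by
  rw [fredholmIntegrand_eq_sum]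
  refine Finset.sum_congr rfl fun σ _ => ?_
  congr 1
  refine (integral_fintype_prod_eq_prod (𝕜 := ℂ) (fun i x =>
    B (κ (σ i)) (y (σ i)) x * A (κ (σ i)) (κ i) x (y i))).symm.trans ?_
  -- Here B carries σ in both its indices, whereas `cycleProd` has σ on A; relabelling x by σ and
  -- reindexing the product of the B's reconciles them.
  rw [← MeasureTheory.integral_comp_perm μ σ]
  refine integral_congr_ae (.of_forall fun x => ?_)
  simp only [cycleProd, Function.comp_apply, Finset.prod_mul_distrib]
  rw [Equiv.prod_comp σ (fun j => B (κ j) (y j) (x j)), mul_comm]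

theorem integrable_fredholmIntegrand_kernelAB (h : KernelFactors μ ν A B g) (n : ℕ)
    (κ : Fin n → ι) :
    Integrable (fredholmIntegrand (kernelAB ν A B) n κ) (Measure.pi fun _ => μ) := by
  have : fredholmIntegrand (kernelAB ν A B) n κ = _ := funext (fredholmIntegrand_kernelAB n κ)
  rw [this]
  exact integrable_finsetSum _ fun σ _ => (h.integrable_cycleProd κ σ).integral_prod_left.smul _

theorem integrable_fredholmIntegrand_kernelBA (h : KernelFactors μ ν A B g) (n : ℕ)
    (κ : Fin n → ι) :
    Integrable (fredholmIntegrand (kernelBA μ A B) n κ) (Measure.pi fun _ => ν) := by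
  have : fredholmIntegrand (kernelBA μ A B) n κ = _ := funext (fredholmIntegrand_kernelBA n κ)
  rw [this]
  exact integrable_finsetSum _ fun σ _ => (h.integrable_cycleProd κ σ).integral_prod_right.smul _

theorem fredholmTerm_kernelAB_eq (h : KernelFactors μ ν A B g) (n : ℕ) :
    fredholmTerm μ (kernelAB ν A B) n = fredholmTerm ν (kernelBA μ A B) n := by
  unfold fredholmTerm
  congr 1
  refine Finset.sum_congr rfl fun κ _ => ?_
  simp only [fredholmIntegrand_kernelAB, fredholmIntegrand_kernelBA]
  rw [integral_finsetSum, integral_finsetSum]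
  rotate_left
  · exact fun σ _ => (h.integrable_cycleProd κ σ).integral_prod_right.smul _
  · exact fun σ _ => (h.integrable_cycleProd κ σ).integral_prod_left.smul _
  refine Finset.sum_congr rfl fun σ _ => ?_
  simp only [Units.smul_def, zsmul_eq_mul]
  rw [integral_const_mul, integral_const_mul, integral_integral_swap (h.integrable_cycleProd κ σ)]

/-- Hadamard applies on this side because the kernel of AB is bounded by ∫ g² and μ has finite mass,
so the n-th term is at most (√n K)ⁿ/n!. -/
theorem summable_fredholmTerm_kernelAB (h : KernelFactors μ ν A B g) :
    Summable (fredholmTerm μ (kernelAB ν A B)) := by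
  set C := ∫ y, g y ^ 2 ∂ν
  refine Summable.of_norm_bounded
    (summable_sqrt_mul_pow_div_factorial (C * (μ.real univ * Fintype.card ι))) fun n => ?_
  rw [fredholmTerm, norm_mul]
  have h1 : ∀ κ : Fin n → ι, ‖∫ x : Fin n → X, fredholmIntegrand (kernelAB ν A B) n κ x
      ∂(Measure.pi fun _ => μ)‖ ≤ (√n * C) ^ n * μ.real univ ^ n := fun κ => by
    refine (norm_integral_le_of_norm_le_const (.of_forall fun x =>
      Matrix.norm_det_le_of_norm_entry_le (C := C) _ fun i j => ?_)).trans_eq ?_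
    · exact h.norm_kernelAB_le _ _ _ _
    · simp [measureReal_def, Measure.pi_univ]
  calc _ ≤ ‖1 / (n ! : ℂ)‖ * ∑ κ : Fin n → ι, (√n * C) ^ n * μ.real univ ^ n := by
        gcongr; exact norm_sum_le_of_le _ fun κ _ => h1 κ
    _ = _ := by
        simp [mul_pow]; ring

theorem hasFredholmDet_kernelAB (h : KernelFactors μ ν A B g) :
    HasFredholmDet μ (kernelAB ν A B) where
  memLp k l := MemLp.of_bound (h.stronglyMeasurable_kernelAB k l).aestronglyMeasurable _
    (.of_forall fun p => h.norm_kernelAB_le k l p.1 p.2)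
  integrable := h.integrable_fredholmIntegrand_kernelAB
  summable := h.summable_fredholmTerm_kernelAB

theorem hasFredholmDet_kernelBA (h : KernelFactors μ ν A B g) :
    HasFredholmDet ν (kernelBA μ A B) where
  memLp k l := by
    rw [memLp_two_iff_integrable_sq_norm (h.stronglyMeasurable_kernelBA k l).aestronglyMeasurable]
    refine ((h.integrable_sq.mul_prod h.integrable_sq).mul_const (μ.real univ ^ 2)).mono'
      ((h.stronglyMeasurable_kernelBA k l).aestronglyMeasurable.norm.pow 2)
      (.of_forall fun p => ?_)
    rw [Real.norm_of_nonneg (by positivity), ← mul_pow, ← mul_pow]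
    gcongr
    exact h.norm_kernelBA_le k l p.1 p.2
  integrable := h.integrable_fredholmIntegrand_kernelBA
  summable := h.summable_fredholmTerm_kernelAB.congr h.fredholmTerm_kernelAB_eq

theorem fredholmDet_kernelAB_eq (h : KernelFactors μ ν A B g) :
    fredholmDet μ (kernelAB ν A B) = fredholmDet ν (kernelBA μ A B) :=
  tsum_congr h.fredholmTerm_kernelAB_eq

end KernelFactors

theorem ae_pi_forall_mem_restrict (μ : Measure X) [SigmaFinite μ] {S : Set X}
    (hS : MeasurableSet S) (n : ℕ) :
    ∀ᵐ x ∂(Measure.pi fun _ : Fin n => μ.restrict S), ∀ i, x i ∈ S := by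
  rw [ae_all_iff]
  intro i
  have h := ae_restrict_mem (μ := μ) hS
  exact (Measure.tendsto_eval_ae_ae (μ := fun _ : Fin n => μ.restrict S) (i := i)).eventually h

/-- Needed because the factorised kernel agrees with the pulled-back one only for parameters in [0,
1]. -/
theorem HasFredholmDet.congr_restrict {μ : Measure X} [SigmaFinite μ] {S : Set X}
    (hS : MeasurableSet S) {K K' : ι → ι → X → X → ℂ}
    (hK : ∀ k l, ∀ x ∈ S, ∀ y ∈ S, K k l x y = K' k l x y)
    (h : HasFredholmDet (μ.restrict S) K) :
    HasFredholmDet (μ.restrict S) K' ∧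
      fredholmDet (μ.restrict S) K = fredholmDet (μ.restrict S) K' := by
  have hint : ∀ (n : ℕ) (κ : Fin n → ι), fredholmIntegrand K n κ
      =ᵐ[Measure.pi fun _ => μ.restrict S] fredholmIntegrand K' n κ := fun n κ => by
    filter_upwards [ae_pi_forall_mem_restrict μ hS n] with x hx
    unfold fredholmIntegrand
    congr 1
    ext i j
    exact hK _ _ _ (hx i) _ (hx j)
  have hterm : fredholmTerm (μ.restrict S) K = fredholmTerm (μ.restrict S) K' := by
    funext n
    unfold fredholmTerm
    congr 1
    exact Finset.sum_congr rfl fun κ _ => integral_congr_ae (hint n κ)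
  refine ⟨⟨fun k l => (memLp_congr_ae ?_).1 (h.memLp k l), fun n κ =>
    (h.integrable n κ).congr (hint n κ), hterm ▸ h.summable⟩, by rw [fredholmDet, hterm]; rfl⟩
  rw [Measure.prod_restrict]
  filter_upwards [ae_restrict_mem (hS.prod hS)] with p hp
  exact hK k l _ hp.1 _ hp.2

end FredholmSwap

/-! ### The cut plane: Painlevé and Liouville arguments. -/

theorem mem_cutSet_iff {a b : ℝ} {z : ℂ} : z ∈ cutSet a b ↔ z.im = 0 ∧ z.re ∈ Icc a b := by
  constructor
  · rintro ⟨t, ht, rfl⟩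
    simpa using ht
  · rintro ⟨h, h'⟩
    exact ⟨z.re, h', Complex.ext (by simp) (by simp [h])⟩

theorem isCompact_cutSet (a b : ℝ) : IsCompact (cutSet a b) :=
  isCompact_Icc.image Complex.continuous_ofReal

theorem isOpen_cutSet_compl (a b : ℝ) : IsOpen (cutSet a b)ᶜ :=
  (isCompact_cutSet a b).isClosed.isOpen_compl

theorem notMem_cutSet_of_im_ne_zero {a b : ℝ} {z : ℂ} (h : z.im ≠ 0) : z ∉ cutSet a b :=
  fun hz => h (mem_cutSet_iff.1 hz).1

theorem ne_of_notMem_cutSet {a b : ℝ} {z : ℂ} (h : z ∉ cutSet a b) {p : ℝ} (hp : p ∈ Icc a b) :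
    z ≠ p := by
  rintro rfl
  exact h (mem_cutSet_iff.2 ⟨by simp, by simpa using hp⟩)

theorem dense_cutSet_compl (a b : ℝ) : Dense (cutSet a b)ᶜ := by
  refine ((dense_compl_singleton (0 : ℝ)).preimage Complex.isOpenMap_im).mono fun z hz => ?_
  exact notMem_cutSet_of_im_ne_zero hz

/-- Painlevé's theorem for a line: a continuous function which is holomorphic off the real line is
entire. -/
theorem Complex.differentiable_of_continuous_of_im_ne_zero {f : ℂ → ℂ} (hc : Continuous f)
    (hd : ∀ z : ℂ, z.im ≠ 0 → DifferentiableAt ℂ f z) : Differentiable ℂ f := by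
  have hrect : ∀ z w : ℂ, (∀ y ∈ Ioo (min z.im w.im) (max z.im w.im), y ≠ 0) →
      (∫ x : ℝ in z.re..w.re, f (x + z.im * I)) - (∫ x : ℝ in z.re..w.re, f (x + w.im * I)) +
      I • (∫ y : ℝ in z.im..w.im, f (w.re + y * I)) -
      I • (∫ y : ℝ in z.im..w.im, f (z.re + y * I)) = 0 := fun z w h =>
    Complex.integral_boundary_rect_eq_zero_of_continuousOn_of_differentiableOn f z w
      hc.continuousOn fun u hu => (hd u (h _ hu.2)).differentiableWithinAt
  -- Morera: a rectangle is split along the real axis into two whose interiors avoid the axis; the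
  -- two integrals along the axis cancel.
  have hcons : Complex.IsConservativeOn f univ := by
    intro z w _
    rw [← add_eq_zero_iff_eq_neg, Complex.wedgeIntegral_add_wedgeIntegral_eq]
    have h1 := hrect z (w.re : ℂ) (by
      intro y hy; rcases le_total z.im 0 with h | h <;> simp [h] at hy
      · exact hy.2.ne
      · exact hy.1.ne')
    have h2 := hrect (z.re : ℂ) w (by
      intro y hy; rcases le_total w.im 0 with h | h <;> simp [h] at hy
      · exact hy.2.ne
      · exact hy.1.ne')
    simp only [Complex.ofReal_re, Complex.ofReal_im] at h1 h2
    have hi : ∀ p : ℝ, ∀ s t : ℝ, IntervalIntegrable (fun y : ℝ => f (p + y * I)) volume s t :=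
      fun p s t => (by fun_prop : Continuous fun y : ℝ => f (p + y * I)).intervalIntegrable s t
    rw [← intervalIntegral.integral_add_adjacent_intervals (hi w.re z.im 0) (hi w.re 0 w.im),
      ← intervalIntegral.integral_add_adjacent_intervals (hi z.re z.im 0) (hi z.re 0 w.im)]
    simp only [smul_eq_mul] at h1 h2 ⊢
    linear_combination h1 + h2
  have := (hcons.isExactOn_univ hc).differentiableOn isOpen_univ
  exact differentiableOn_univ.1 this

/-- Near an interior point of the cut, being off the cut means being off the real axis, so the two
one-sided limits determine the limit. -/
theorem nhdsWithin_cutSet_compl_le {a b s : ℝ} (hs : s ∈ Ioo a b) :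
    𝓝[(cutSet a b)ᶜ] (s : ℂ) ≤ 𝓝[{z : ℂ | 0 < z.im}] (s : ℂ) ⊔ 𝓝[{z : ℂ | z.im < 0}] (s : ℂ) := by
  rw [← nhdsWithin_union]
  have hU : re ⁻¹' Ioo a b ∈ 𝓝 (s : ℂ) :=
    (isOpen_Ioo.preimage Complex.continuous_re).mem_nhds (by simpa using hs)
  rw [← nhdsWithin_inter_of_mem (t := (cutSet a b)ᶜ) (mem_nhdsWithin_of_mem_nhds hU)]
  refine nhdsWithin_mono _ fun z hz => ?_
  by_contra h
  simp only [mem_union, mem_ofPred_eq, not_or, not_lt] at h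
  exact hz.2 (mem_cutSet_iff.2 ⟨le_antisymm h.1 h.2, Ioo_subset_Icc_self hz.1⟩)

/-- A function holomorphic off `[a, b]`, without jump, with at worst weak singularities at `a`
and `b` and with a limit at infinity is constant. -/
theorem eq_of_tendsto_of_no_jump {a b : ℝ} (hab : a < b) {d : ℂ → ℂ} {c : ℂ}
    (hd : DifferentiableOn ℂ d (cutSet a b)ᶜ)
    (hjump : ∀ s ∈ Ioo a b, ∃ ℓ, Tendsto d (𝓝[{z : ℂ | 0 < z.im}] (s : ℂ)) (𝓝 ℓ) ∧
      Tendsto d (𝓝[{z : ℂ | z.im < 0}] (s : ℂ)) (𝓝 ℓ))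
    (hend : ∀ p : ℝ, p = a ∨ p = b →
      Tendsto (fun z => (z - p) * d z) (𝓝[(cutSet a b)ᶜ] (p : ℂ)) (𝓝 0))
    (hinf : Tendsto d (Bornology.cobounded ℂ) (𝓝 c)) {z : ℂ} (hz : z ∉ cutSet a b) : d z = c := by
  have haJ : a ∈ Icc a b := ⟨le_rfl, hab.le⟩
  have hbJ : b ∈ Icc a b := ⟨hab.le, le_rfl⟩
  -- The factor kills both end point singularities, so that f extends continuously to the whole
  -- plane.
  set f : ℂ → ℂ := fun z => (z - a) * (z - b) * d z with hf
  have hfd : DifferentiableOn ℂ f (cutSet a b)ᶜ := by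
    refine DifferentiableOn.mul (Differentiable.differentiableOn (by fun_prop)) hd
  have hfa : Tendsto f (𝓝[(cutSet a b)ᶜ] (a : ℂ)) (𝓝 0) := by
    have h1 : Tendsto (fun z : ℂ => z - b) (𝓝[(cutSet a b)ᶜ] (a : ℂ)) (𝓝 (a - b)) :=
      (Continuous.tendsto (by fun_prop) _).mono_left nhdsWithin_le_nhds
    simpa [hf, mul_assoc, mul_left_comm] using h1.mul (hend a (.inl rfl))
  have hfb : Tendsto f (𝓝[(cutSet a b)ᶜ] (b : ℂ)) (𝓝 0) := by
    have h1 : Tendsto (fun z : ℂ => z - a) (𝓝[(cutSet a b)ᶜ] (b : ℂ)) (𝓝 (b - a)) :=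
      (Continuous.tendsto (by fun_prop) _).mono_left nhdsWithin_le_nhds
    simpa [hf, mul_assoc, mul_left_comm] using h1.mul (hend b (.inr rfl))
  have hlim : ∀ x, ∃ y, Tendsto f (𝓝[(cutSet a b)ᶜ] x) (𝓝 y) := by
    intro x
    by_cases hx : x ∈ cutSet a b
    · obtain ⟨s, hs, rfl⟩ := hx
      rcases hs.1.eq_or_lt with rfl | h1
      · exact ⟨0, hfa⟩
      rcases hs.2.eq_or_lt with rfl | h2
      · exact ⟨0, hfb⟩
      obtain ⟨ℓ, hp, hm⟩ := hjump s ⟨h1, h2⟩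
      refine ⟨(s - a) * (s - b) * ℓ, ?_⟩
      have h3 : Tendsto (fun z : ℂ => (z - a) * (z - b)) (𝓝[(cutSet a b)ᶜ] (s : ℂ))
          (𝓝 ((s - a) * (s - b))) :=
        (Continuous.tendsto (by fun_prop) _).mono_left nhdsWithin_le_nhds
      exact h3.mul ((hp.sup hm).mono_left (nhdsWithin_cutSet_compl_le ⟨h1, h2⟩))
    · exact ⟨f x, hfd.continuousOn x hx⟩
  set E := extendFrom (cutSet a b)ᶜ f
  have hEc : Continuous E := continuous_extendFrom (dense_cutSet_compl a b) hlim
  have hEf : ∀ x ∉ cutSet a b, E x = f x := extendFrom_extends hfd.continuousOn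
  have hEa : E a = 0 := extendFrom_eq (dense_cutSet_compl a b _) hfa
  have hEb : E b = 0 := extendFrom_eq (dense_cutSet_compl a b _) hfb
  have hEd : Differentiable ℂ E := by
    refine Complex.differentiable_of_continuous_of_im_ne_zero hEc fun x hx => ?_
    have hxJ := (isOpen_cutSet_compl a b).mem_nhds (notMem_cutSet_of_im_ne_zero hx)
    refine (hfd.differentiableAt hxJ).congr_of_eventuallyEq ?_
    filter_upwards [hxJ] with y hy using hEf y hy
  -- As E vanishes at a and at b, two divided differences divide (z - a)(z - b) out again and leave
  -- an entire extension of d, to which Liouville's theorem applies.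
  have hE1 : Differentiable ℂ (dslope E a) :=
    differentiableOn_univ.1 ((Complex.differentiableOn_dslope univ_mem).2 hEd.differentiableOn)
  have hE2 : Differentiable ℂ (dslope (dslope E a) b) :=
    differentiableOn_univ.1 ((Complex.differentiableOn_dslope univ_mem).2 hE1.differentiableOn)
  have hba : (b : ℂ) ≠ a := by exact_mod_cast hab.ne'
  have hEq : ∀ x ∉ cutSet a b, dslope (dslope E a) b x = d x := by
    intro x hx
    have hxa := ne_of_notMem_cutSet hx haJ
    have hxb := ne_of_notMem_cutSet hx hbJ
    rw [dslope_of_ne _ hxb, slope_def_field, dslope_of_ne _ hxa, dslope_of_ne _ hba,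
      slope_def_field, slope_def_field, hEa, hEb, hEf x hx]
    have := sub_ne_zero.2 hxa
    have := sub_ne_zero.2 hxb
    simp only [hf]
    field_simp
    simp
  rw [← hEq z hz]
  refine hE2.apply_eq_of_tendsto_cocompact z ?_
  rw [← Metric.cobounded_eq_cocompact]
  refine hinf.congr' ?_
  filter_upwards [Bornology.IsBounded.compl (isCompact_cutSet a b).isBounded] with x hx
    using (hEq x hx).symm

/-- Because r |log r|ⁿ → 0 as r → 0⁺. The power matters: a determinant of N × N logarithmic entries
is only O(|log|ᴺ). -/
theorem tendsto_sub_mul_zero_of_isBigO_log_pow {l : Filter ℂ} {p : ℂ} (hl : l ≤ 𝓝[≠] p)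
    {d : ℂ → ℂ} {n : ℕ} (hd : d =O[l] fun z => Real.log ‖z - p‖ ^ n) :
    Tendsto (fun z => (z - p) * d z) l (𝓝 0) := by
  have h0 : Tendsto (fun z => ‖z - p‖) l (𝓝[>] 0) := (tendsto_norm_sub_self_nhdsNE p).mono_left hl
  have h1 : Tendsto (fun r : ℝ => r * Real.log r ^ n) (𝓝[>] 0) (𝓝 0) := by
    have := (isLittleO_abs_log_rpow_rpow_nhdsGT_zero (n : ℝ) (s := -1) (by norm_num))
    have h2 := this.tendsto_div_nhds_zero
    rw [tendsto_zero_iff_norm_tendsto_zero]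
    refine h2.congr' ?_
    filter_upwards [self_mem_nhdsWithin] with r hr
    have hr' : (0 : ℝ) < r := hr
    rw [Real.rpow_natCast, Real.rpow_neg_one, norm_mul, norm_pow, Real.norm_of_nonneg hr'.le,
      Real.norm_eq_abs]
    field_simp
  have h3 := (Asymptotics.isBigO_refl (fun z => z - p) l).norm_right.mul hd
  refine h3.trans_tendsto ?_
  rw [tendsto_zero_iff_norm_tendsto_zero]
  have h4 := (h1.comp h0).norm
  simpa [Function.comp_def] using h4

/-! ### Determinant and inverse of χ. -/

namespace IsRHPSolution

variable {N : ℕ} {a b : ℝ} {EL ER : ℝ → Fin N → ℂ} {χ : ℂ → Matrix (Fin N) (Fin N) ℂ}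

theorem tendsto_one (hχ : IsRHPSolution a b EL ER χ) :
    Tendsto χ (Bornology.cobounded ℂ) (𝓝 1) := by
  refine tendsto_pi_nhds.2 fun i => tendsto_pi_nhds.2 fun j => ?_
  have h := (hχ.infinity i j).trans_tendsto Filter.tendsto_inv₀_cobounded
  simpa using h.add_const ((1 : Matrix (Fin N) (Fin N) ℂ) i j)

theorem differentiableOn_det (hχ : IsRHPSolution a b EL ER χ) :
    DifferentiableOn ℂ (fun z => (χ z).det) (cutSet a b)ᶜ := by
  simp only [Matrix.det_apply]
  refine DifferentiableOn.fun_sum fun σ _ => ?_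
  refine DifferentiableOn.const_smul (DifferentiableOn.fun_finsetProd fun i _ => ?_) _
  exact hχ.holomorphic _ _

theorem det_isBigO (hχ : IsRHPSolution a b EL ER χ) {p : ℝ} (hp : p = a ∨ p = b) :
    (fun z => (χ z).det) =O[𝓝[(cutSet a b)ᶜ] (p : ℂ)] fun z => Real.log ‖z - (p : ℂ)‖ ^ N := by
  simp only [Matrix.det_apply]
  refine Asymptotics.IsBigO.fun_sum fun σ _ => ?_
  simp only [Units.smul_def, zsmul_eq_mul]
  refine Asymptotics.IsBigO.const_mul_left ?_ _
  have := Asymptotics.IsBigO.finsetProd (s := Finset.univ) fun i (_ : i ∈ Finset.univ) =>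
    hχ.endpoints p hp (σ i) i
  simpa using this

/-- The jump has determinant 1 + 2πi E_Lᵀ E_R = 1, so det χ does not jump; its end point
singularities are weak and it tends to 1 at infinity. -/
theorem det_eq_one (hab : a < b) (hreg : ∀ s ∈ Icc a b, EL s ⬝ᵥ ER s = 0)
    (hχ : IsRHPSolution a b EL ER χ) {z : ℂ} (hz : z ∉ cutSet a b) : (χ z).det = 1 := by
  have hcont : Continuous fun A : Matrix (Fin N) (Fin N) ℂ => A.det := continuous_id.matrix_det
  refine eq_of_tendsto_of_no_jump hab hχ.differentiableOn_det ?_ ?_ ?_ hz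
  · obtain ⟨χp, χm, -, -, h⟩ := hχ.jump
    intro s hs
    obtain ⟨hp, hm, he⟩ := h s hs
    refine ⟨(χp s).det, (hcont.tendsto _).comp hp, ?_⟩
    have hdet : (χm s).det = (χp s).det := by
      rw [he, Matrix.det_mul, ← Matrix.smul_vecMulVec, Matrix.vecMulVec_eq Unit,
        Matrix.det_one_add_replicateCol_mul_replicateRow, dotProduct_smul,
        hreg s (Ioo_subset_Icc_self hs)]
      simp
    rw [← hdet]
    exact (hcont.tendsto _).comp hm
  · intro p hp
    refine tendsto_sub_mul_zero_of_isBigO_log_pow (nhdsWithin_mono _ fun z hz => ?_)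
      (hχ.det_isBigO hp)
    exact ne_of_notMem_cutSet hz (by rcases hp with rfl | rfl <;> simp [hab.le])
  · simpa [Function.comp_def] using (hcont.tendsto _).comp hχ.tendsto_one

theorem inv_eq_adjugate (hab : a < b) (hreg : ∀ s ∈ Icc a b, EL s ⬝ᵥ ER s = 0)
    (hχ : IsRHPSolution a b EL ER χ) {z : ℂ} (hz : z ∉ cutSet a b) : (χ z)⁻¹ = (χ z).adjugate := by
  rw [Matrix.inv_def, hχ.det_eq_one hab hreg hz]; simp

/-- With det χ = 1 the inverse is the adjugate, whose entries are polynomials in those of χ. -/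
theorem differentiableOn_inv (hab : a < b) (hreg : ∀ s ∈ Icc a b, EL s ⬝ᵥ ER s = 0)
    (hχ : IsRHPSolution a b EL ER χ) (i j : Fin N) :
    DifferentiableOn ℂ (fun z => (χ z)⁻¹ i j) (cutSet a b)ᶜ := by
  have h : DifferentiableOn ℂ (fun z => (χ z).adjugate i j) (cutSet a b)ᶜ := by
    simp only [Matrix.adjugate_apply, Matrix.det_apply]
    refine DifferentiableOn.fun_sum fun σ _ => ?_
    refine DifferentiableOn.const_smul (DifferentiableOn.fun_finsetProd fun k _ => ?_) _
    by_cases hk : σ k = j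
    · simp only [hk, Matrix.updateRow_self]
      exact differentiableOn_const _
    · simp only [Matrix.updateRow_ne hk]
      exact hχ.holomorphic _ _
  exact h.congr fun z hz => by rw [hχ.inv_eq_adjugate hab hreg hz]

/-- From χ⁻¹ - 1 = -χ⁻¹(χ - 1), where χ⁻¹ is bounded near infinity. -/
theorem inv_infinity (hab : a < b) (hreg : ∀ s ∈ Icc a b, EL s ⬝ᵥ ER s = 0)
    (hχ : IsRHPSolution a b EL ER χ) (i j : Fin N) :
    (fun z => (χ z)⁻¹ i j - (1 : Matrix (Fin N) (Fin N) ℂ) i j)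
      =O[Bornology.cobounded ℂ] fun z => z⁻¹ := by
  have hlim : Tendsto (fun z => (χ z).adjugate) (Bornology.cobounded ℂ) (𝓝 1) := by
    have := ((continuous_id.matrix_adjugate).tendsto (1 : Matrix (Fin N) (Fin N) ℂ)).comp
      hχ.tendsto_one
    simpa [Function.comp_def] using this
  have hb : ∀ k, (fun z => (χ z).adjugate i k) =O[Bornology.cobounded ℂ] fun _ => (1 : ℂ) :=
    fun k => ((tendsto_pi_nhds.1 (tendsto_pi_nhds.1 hlim i)) k).isBigO_one ℂ
  have hs : (fun z => ∑ k, (χ z).adjugate i k *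
      (χ z k j - (1 : Matrix (Fin N) (Fin N) ℂ) k j)) =O[Bornology.cobounded ℂ] fun z => z⁻¹ :=
    Asymptotics.IsBigO.fun_sum fun k _ => by simpa using (hb k).mul (hχ.infinity k j)
  refine hs.neg_left.congr' ?_ .rfl
  filter_upwards [Bornology.IsBounded.compl (isCompact_cutSet a b).isBounded] with z hz
  rw [hχ.inv_eq_adjugate hab hreg hz]
  have h1 : (χ z).adjugate * (χ z - 1) = 1 - (χ z).adjugate := by
    rw [mul_sub, Matrix.adjugate_mul, hχ.det_eq_one hab hreg hz, one_smul, mul_one]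
  have h2 := congrFun (congrFun h1 i) j
  rw [Matrix.mul_apply] at h2
  simp only [Matrix.sub_apply] at h2
  rw [h2]; ring

end IsRHPSolution

/-! ### Primitives off the cut. -/

/-- A holomorphic function on an open set which is star-shaped about `0` has a primitive. -/
theorem exists_primitive_of_starConvex_zero {U : Set ℂ} (hU : IsOpen U)
    (hstar : ∀ u ∈ U, ∀ t ∈ Icc (0 : ℝ) 1, (t : ℂ) * u ∈ U) {h : ℂ → ℂ}
    (hd : DifferentiableOn ℂ h U) : ∃ G : ℂ → ℂ, ∀ u ∈ U, HasDerivAt G (h u) u := by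
  have hd' : DifferentiableOn ℂ (deriv h) U := hd.deriv hU
  refine ⟨fun u => u * ∫ t in (0 : ℝ)..1, h (t * u), fun u hu => ?_⟩
  obtain ⟨ε, hε, hball⟩ := Metric.nhds_basis_closedBall.mem_iff.1 (hU.mem_nhds hu)
  set S : Set (ℝ × ℂ) := Icc (0 : ℝ) 1 ×ˢ Metric.closedBall u ε
  have hScomp : IsCompact S := isCompact_Icc.prod (isCompact_closedBall u ε)
  have hSU : MapsTo (fun p : ℝ × ℂ => (p.1 : ℂ) * p.2) S U := fun p hp =>
    hstar _ (hball hp.2) _ hp.1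
  have hcont : ∀ g : ℂ → ℂ, ContinuousOn g U → ∀ w ∈ Metric.closedBall u ε,
      ContinuousOn (fun t : ℝ => g (t * w)) (Icc 0 1) := fun g hg w hw =>
    hg.comp (Continuous.continuousOn (by fun_prop)) fun t ht => hstar _ (hball hw) _ ht
  obtain ⟨C, hC⟩ := hScomp.exists_bound_of_continuousOn
    (hd'.continuousOn.comp (Continuous.continuousOn (by fun_prop)) hSU)
  have hsub : uIoc (0 : ℝ) 1 ⊆ Icc 0 1 := by
    rw [uIoc_of_le zero_le_one]; exact Ioc_subset_Icc_self
  have huIcc : uIcc (0 : ℝ) 1 = Icc 0 1 := uIcc_of_le zero_le_one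
  have huε : u ∈ Metric.closedBall u ε := Metric.mem_closedBall_self hε.le
  have hinth : IntervalIntegrable (fun t : ℝ => h (t * u)) volume 0 1 :=
    (huIcc ▸ hcont h hd.continuousOn u huε).intervalIntegrable
  have hmain := (intervalIntegral.hasDerivAt_integral_of_dominated_loc_of_deriv_le (μ := volume)
    (F := fun w (t : ℝ) => h (t * w)) (F' := fun w (t : ℝ) => t * deriv h (t * w)) (x₀ := u)
    (a := 0) (b := 1) (bound := fun _ => C) (Metric.closedBall_mem_nhds u hε) ?_ hinth ?_ ?_ ?_ ?_)
  · have hint' := hmain.1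
    have h1 := (hasDerivAt_id u).mul hmain.2
    simp only [id, one_mul] at h1
    refine h1.congr_deriv ?_
    rw [← intervalIntegral.integral_const_mul, ← intervalIntegral.integral_add hinth
      (hint'.const_mul u)]
    -- The derivative of u ∫₀¹ h(tu) dt has integrand h(tu) + tu h'(tu) = d/dt [t h(tu)], which
    -- integrates to h(u).
    have hFTC := intervalIntegral.integral_eq_sub_of_hasDerivAt (a := 0) (b := 1)
      (f := fun t : ℝ => (t : ℂ) * h (t * u))
      (f' := fun t : ℝ => h (t * u) + u * (t * deriv h (t * u))) (fun t ht => ?_)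
      (hinth.add (hint'.const_mul u))
    · rw [hFTC]; simp
    · have htU : (t : ℂ) * u ∈ U := hstar u hu t (huIcc ▸ ht)
      have h2 : HasDerivAt h (deriv h (t * u)) ((t : ℂ) * u) :=
        (hd.differentiableAt (hU.mem_nhds htU)).hasDerivAt
      have h3 : HasDerivAt (fun s : ℂ => s * h (s * u))
          (1 * h (t * u) + t * (deriv h (t * u) * (1 * u))) (t : ℂ) :=
        (hasDerivAt_id (t : ℂ)).mul (h2.comp (t : ℂ) ((hasDerivAt_id (t : ℂ)).mul_const u))
      refine h3.comp_ofReal.congr_deriv ?_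
      ring
  · filter_upwards [Metric.closedBall_mem_nhds u hε] with w hw
    exact ((hcont h hd.continuousOn w hw).mono hsub).aestronglyMeasurable measurableSet_uIoc
  · refine ContinuousOn.aestronglyMeasurable (ContinuousOn.mono ?_ hsub) measurableSet_uIoc
    exact (Continuous.continuousOn (by fun_prop)).mul (hcont _ hd'.continuousOn u huε)
  · refine .of_forall fun t ht w hw => ?_
    have ht' := hsub ht
    rw [norm_mul, Complex.norm_real, Real.norm_of_nonneg ht'.1]
    exact (mul_le_of_le_one_left (norm_nonneg _) ht'.2).trans (hC (t, w) ⟨ht', hw⟩)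
  · exact intervalIntegrable_const
  · refine .of_forall fun t ht w hw => ?_
    have htU : (t : ℂ) * w ∈ U := hstar w (hball hw) t (hsub ht)
    have h2 : HasDerivAt h (deriv h (t * w)) ((t : ℂ) * w) :=
      (hd.differentiableAt (hU.mem_nhds htU)).hasDerivAt
    refine (h2.comp w ((hasDerivAt_id w).const_mul (t : ℂ))).congr_deriv ?_
    ring

/-- A function holomorphic off `[a, b]` which is `O(z⁻²)` at infinity has there a primitive with a
limit at infinity. -/
theorem exists_primitive_of_isBigO_inv_sq {a b : ℝ} (hab : a < b) {f : ℂ → ℂ}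
    (hf : DifferentiableOn ℂ f (cutSet a b)ᶜ)
    (hO : f =O[Bornology.cobounded ℂ] fun z => (z⁻¹) ^ 2) :
    ∃ G : ℂ → ℂ, (∀ z ∉ cutSet a b, HasDerivAt G (f z) z) ∧
      ∃ ℓ, Tendsto G (Bornology.cobounded ℂ) (𝓝 ℓ) := by
  -- The inversion u = 1/(z - a) sends [a, b] to the ray [r, ∞], whose complement U is star-shaped
  -- about 0, the image of z = ∞.
  set r : ℝ := (b - a)⁻¹
  have hr : 0 < r := inv_pos.2 (sub_pos.2 hab)
  set U : Set ℂ := {u : ℂ | u.im = 0 ∧ r ≤ u.re}ᶜ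
  have hU : IsOpen U := by
    refine isOpen_compl_iff.2 ?_
    exact (isClosed_eq Complex.continuous_im continuous_const).inter
      (isClosed_le continuous_const Complex.continuous_re)
  have h0U : (0 : ℂ) ∈ U := fun h => by
    have := h.2; simp at this; linarith
  have hstar : ∀ u ∈ U, ∀ t ∈ Icc (0 : ℝ) 1, (t : ℂ) * u ∈ U := by
    intro u hu t ht hmem
    obtain ⟨h1, h2⟩ := hmem
    simp only [Complex.mul_im, Complex.mul_re, Complex.ofReal_re, Complex.ofReal_im, zero_mul,
      add_zero, sub_zero, mul_eq_zero] at h1 h2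
    rcases h1 with h1 | h1
    · rw [h1, zero_mul] at h2; linarith
    · refine hu ⟨h1, ?_⟩
      have : 0 < u.re := by
        by_contra hneg
        have := mul_nonpos_of_nonneg_of_nonpos ht.1 (not_lt.1 hneg)
        linarith
      nlinarith [ht.2]
  have hmaps : ∀ u ∈ U, u ≠ 0 → (a : ℂ) + u⁻¹ ∉ cutSet a b := by
    intro u hu hu0 hmem
    rw [mem_cutSet_iff] at hmem
    obtain ⟨h1, h2⟩ := hmem
    simp only [Complex.add_im, Complex.add_re, Complex.ofReal_im, Complex.ofReal_re, zero_add,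
      mem_Icc] at h1 h2
    have hx : u⁻¹ = ((u⁻¹.re : ℝ) : ℂ) := Complex.ext (by simp) (by simpa using h1)
    set x := u⁻¹.re
    have hx0 : x ≠ 0 := fun h => by
      rw [h] at hx; exact hu0 (by simpa using hx)
    have hxpos : 0 < x := lt_of_le_of_ne (by linarith [h2.1]) hx0.symm
    have hux : u = ((x⁻¹ : ℝ) : ℂ) := by
      rw [Complex.ofReal_inv, ← hx, inv_inv]
    refine hu ⟨by rw [hux]; simp, ?_⟩
    rw [hux, Complex.ofReal_re]
    exact inv_anti₀ hxpos (by linarith [h2.2])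
  have hmaps' : ∀ z ∉ cutSet a b, (z - a)⁻¹ ∈ U := by
    intro z hz hmem
    obtain ⟨h1, h2⟩ := hmem
    have hx : (z - a)⁻¹ = (((z - a)⁻¹.re : ℝ) : ℂ) := Complex.ext (by simp) (by simpa using h1)
    set x := (z - a)⁻¹.re
    have hz' : z = ((a + x⁻¹ : ℝ) : ℂ) := by
      push_cast; rw [← hx, inv_inv]; ring
    have hxpos : 0 < x := hr.trans_le h2
    refine hz (mem_cutSet_iff.2 ⟨by rw [hz', Complex.ofReal_im], ?_⟩)
    rw [hz', Complex.ofReal_re]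
    refine ⟨by linarith [inv_pos.2 hxpos], ?_⟩
    have := inv_anti₀ hr h2
    rw [inv_inv] at this
    linarith
  -- The form f(z) dz in the coordinate u. The decay O(z⁻²) makes it bounded near u = 0, hence a
  -- removable singularity.
  set h₀ : ℂ → ℂ := fun u => -f (a + u⁻¹) * (u⁻¹) ^ 2 with hh₀
  have hinv : Tendsto (fun u : ℂ => (a : ℂ) + u⁻¹) (𝓝[≠] 0) (Bornology.cobounded ℂ) :=
    tendsto_const_add_cobounded _ |>.comp Filter.tendsto_inv₀_nhdsNE_zero
  have hbdd : IsBoundedUnder (· ≤ ·) (𝓝[≠] (0 : ℂ)) fun u => ‖h₀ u - h₀ 0‖ := by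
    obtain ⟨C, hC⟩ := (hO.comp_tendsto hinv).bound
    have hlim : Tendsto (fun u : ℂ => ‖((a : ℂ) * u + 1)⁻¹‖ ^ 2) (𝓝[≠] 0) (𝓝 1) := by
      have h1 : ContinuousAt (fun u : ℂ => ‖((a : ℂ) * u + 1)⁻¹‖ ^ 2) 0 := by
        refine ContinuousAt.pow (ContinuousAt.norm (ContinuousAt.inv₀ (by fun_prop) (by simp))) 2
      simpa using h1.tendsto.mono_left nhdsWithin_le_nhds
    refine ⟨|C| * 2 + ‖h₀ 0‖, eventually_map.2 ?_⟩
    filter_upwards [hC, hlim.eventually (gt_mem_nhds one_lt_two), self_mem_nhdsWithin]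
      with u hu hu2 hu0
    refine norm_sub_le_of_le ?_ le_rfl
    have hu0' : u ≠ 0 := hu0
    have heq : ((a : ℂ) * u + 1)⁻¹ = ((a : ℂ) + u⁻¹)⁻¹ * u⁻¹ := by
      rw [← mul_inv]; congr 1; field_simp
    simp only [Function.comp_apply, norm_pow] at hu
    rw [heq, norm_mul, mul_pow] at hu2
    rw [hh₀, norm_mul, norm_neg, norm_pow]
    calc _ ≤ C * ‖((a : ℂ) + u⁻¹)⁻¹‖ ^ 2 * ‖u⁻¹‖ ^ 2 := by gcongr
      _ ≤ |C| * (‖((a : ℂ) + u⁻¹)⁻¹‖ ^ 2 * ‖u⁻¹‖ ^ 2) := by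
        rw [mul_assoc]; gcongr; exact le_abs_self C
      _ ≤ _ := by gcongr
  have hdiff₀ : DifferentiableOn ℂ h₀ (U \ {0}) := by
    intro u hu
    have hu0 : u ≠ 0 := hu.2
    have h1 : DifferentiableAt ℂ f (a + u⁻¹) :=
      hf.differentiableAt ((isOpen_cutSet_compl a b).mem_nhds (hmaps u hu.1 hu0))
    have h2 : DifferentiableAt ℂ (fun u : ℂ => (a : ℂ) + u⁻¹) u :=
      (differentiableAt_inv hu0).const_add _
    have h3 : DifferentiableAt ℂ (fun u : ℂ => f (a + u⁻¹)) u := h1.comp u h2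
    exact (h3.neg.mul ((differentiableAt_inv hu0).pow 2)).differentiableWithinAt
  have hdiff := Complex.differentiableOn_update_limUnder_of_isLittleO (hU.mem_nhds h0U) hdiff₀
    (by simpa using hbdd.isLittleO_sub_self_inv)
  obtain ⟨G, hG⟩ := exists_primitive_of_starConvex_zero hU hstar hdiff
  refine ⟨fun z => G ((z - a)⁻¹), fun z hz => ?_, G 0, ?_⟩
  · have hza : z - a ≠ 0 := sub_ne_zero.2 (ne_of_notMem_cutSet hz ⟨le_rfl, hab.le⟩)
    have h1 := hG _ (hmaps' z hz)
    rw [Function.update_of_ne (inv_ne_zero hza)] at h1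
    have h2 := ((hasDerivAt_id z).sub_const (a : ℂ)).inv hza
    refine (h1.comp z h2).congr_deriv ?_
    simp only [hh₀, inv_inv, id]
    rw [add_sub_cancel]
    field_simp
  · have h1 : Tendsto (fun z : ℂ => (z - a)⁻¹) (Bornology.cobounded ℂ) (𝓝 0) :=
      Filter.tendsto_inv₀_cobounded.comp (tendsto_sub_const_cobounded (a : ℂ))
    exact ((hG 0 h0U).continuousAt.tendsto).comp h1

theorem isBigO_inv_sub_cobounded (p : ℂ) :
    (fun z : ℂ => (z - p)⁻¹) =O[Bornology.cobounded ℂ] fun z => z⁻¹ := by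
  refine Asymptotics.IsBigO.of_bound 2 ?_
  filter_upwards [tendsto_norm_cobounded_atTop.eventually_ge_atTop (2 * ‖p‖ + 1)] with z hz
  have h1 : ‖z‖ / 2 ≤ ‖z - p‖ := by linarith [norm_sub_norm_le z p, norm_nonneg p]
  have h0 : 0 < ‖z‖ := by linarith [norm_nonneg p]
  rw [norm_inv, norm_inv]
  calc _ ≤ (‖z‖ / 2)⁻¹ := inv_anti₀ (by positivity) h1
    _ = _ := by field_simp

/-- Subtracting from `F(z) / (z - p)` its poles at `p` and (roughly) at infinity leaves a function
with a primitive off `[a, b]`. -/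
theorem exists_primitive_dslope_sub {a b : ℝ} (hab : a < b) {F : ℂ → ℂ} {L : ℂ}
    (hF : DifferentiableOn ℂ F (cutSet a b)ᶜ)
    (hL : (fun z => F z - L) =O[Bornology.cobounded ℂ] fun z => z⁻¹) {p : ℂ}
    (hp : p ∉ cutSet a b) :
    ∃ G : ℂ → ℂ, (∀ z ∉ cutSet a b, z ≠ p →
      HasDerivAt G (F z / (z - p) - F p / (z - p) - (L - F p) / (z - a)) z) ∧
      ∃ ℓ, Tendsto G (Bornology.cobounded ℂ) (𝓝 ℓ) := by
  -- The divided difference has 1/z coefficient L - F(p) at infinity. It is cancelled by a pole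
  -- placed at a, which lies on the cut and so costs no holomorphy.
  have hd : DifferentiableOn ℂ (fun z => dslope F p z - (L - F p) / (z - a)) (cutSet a b)ᶜ := by
    refine DifferentiableOn.sub ((Complex.differentiableOn_dslope
      ((isOpen_cutSet_compl a b).mem_nhds hp)).2 hF) fun z hz => ?_
    refine DifferentiableAt.differentiableWithinAt (DifferentiableAt.div (by fun_prop)
      (by fun_prop) (sub_ne_zero.2 (ne_of_notMem_cutSet hz ⟨le_rfl, hab.le⟩)))
  have hO : (fun z => dslope F p z - (L - F p) / (z - a)) =O[Bornology.cobounded ℂ]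
      fun z => (z⁻¹) ^ 2 := by
    have h1 : (fun z => (F z - L) * (z - p)⁻¹ + ((L - F p) * (p - a)) * ((z - p)⁻¹ * (z - a)⁻¹))
        =O[Bornology.cobounded ℂ] fun z => (z⁻¹) ^ 2 := by
      simp only [sq]
      exact (hL.mul (isBigO_inv_sub_cobounded p)).add
        (((isBigO_inv_sub_cobounded p).mul (isBigO_inv_sub_cobounded a)).const_mul_left _)
    refine h1.congr' ?_ .rfl
    filter_upwards [Bornology.IsBounded.compl (isCompact_cutSet a b).isBounded,
      Bornology.IsBounded.compl (Bornology.isBounded_singleton (x := p))] with z hz hzp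
    have hzp' : z ≠ p := hzp
    have h2 := sub_ne_zero.2 hzp'
    have h3 := sub_ne_zero.2 (ne_of_notMem_cutSet hz ⟨le_rfl, hab.le⟩)
    rw [dslope_of_ne _ hzp', slope_def_field]
    field_simp
    ring
  obtain ⟨G, hG, hℓ⟩ := exists_primitive_of_isBigO_inv_sq hab hd hO
  refine ⟨G, fun z hz hzp => (hG z hz).congr_deriv ?_, hℓ⟩
  rw [dslope_of_ne _ hzp, slope_def_field, sub_div]

/-! ### Piecewise C¹ loops and Cauchy's formula outside them. -/

namespace IsPiecewiseC1

variable {Γ : ℝ → ℂ}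

/-- In the open interval `deriv` coincides with `derivWithin`, which is continuous on the compact
closed one. -/
theorem exists_norm_deriv_le_Ioo {x y : ℝ} (hxy : x < y) (h : ContDiffOn ℝ 1 Γ (Icc x y)) :
    ∃ D, ∀ t ∈ Ioo x y, ‖deriv Γ t‖ ≤ D := by
  obtain ⟨D, hD⟩ := isCompact_Icc.exists_bound_of_continuousOn
    (h.continuousOn_derivWithin (uniqueDiffOn_Icc hxy) le_rfl)
  refine ⟨D, fun t ht => ?_⟩
  rw [← derivWithin_of_mem_nhds (Icc_mem_nhds ht.1 ht.2)]
  exact hD t (Ioo_subset_Icc_self ht)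

theorem exists_differentiableAt (hΓ : IsPiecewiseC1 Γ) :
    ∃ P : Finset ℝ, ∀ t ∈ Ioo (0 : ℝ) 1 \ (P : Set ℝ), DifferentiableAt ℝ Γ t := by
  obtain ⟨-, P, hP⟩ := hΓ
  refine ⟨P, fun t ht => ?_⟩
  have hopen : IsOpen (Ioo (0 : ℝ) 1 \ (P : Set ℝ)) := isOpen_Ioo.sdiff P.finite_toSet.isClosed
  obtain ⟨ε, hε, hball⟩ := Metric.nhds_basis_closedBall.mem_iff.1 (hopen.mem_nhds ht)
  rw [Real.closedBall_eq_Icc] at hball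
  have h := hP (t - ε) (t + ε) (by linarith)
    (fun s hs => Ioo_subset_Icc_self (hball hs).1)
    (disjoint_left.2 fun s hs => (hball (Ioo_subset_Icc_self hs)).2)
  exact (h.differentiableOn one_ne_zero).differentiableAt
    (Icc_mem_nhds (by linarith) (by linarith))

theorem exists_norm_deriv_le (hΓ : IsPiecewiseC1 Γ) :
    ∃ D, 0 ≤ D ∧ ∀ t ∈ Icc (0 : ℝ) 1, ‖deriv Γ t‖ ≤ D := by
  obtain ⟨-, P, hP⟩ := hΓ
  suffices h : ∃ D, ∀ t ∈ Icc (0 : ℝ) 1, ‖deriv Γ t‖ ≤ D by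
    obtain ⟨D, hD⟩ := h
    exact ⟨D, (norm_nonneg _).trans (hD 0 (by simp)), hD⟩
  refine isCompact_Icc.induction_on (p := fun s => ∃ D, ∀ t ∈ s, ‖deriv Γ t‖ ≤ D) ⟨0, by simp⟩
    (fun s t hst ⟨D, hD⟩ => ⟨D, fun x hx => hD x (hst hx)⟩)
    (fun s t ⟨D, hD⟩ ⟨D', hD'⟩ => ⟨max D D', fun x hx => hx.elim
      (fun h => (hD x h).trans (le_max_left _ _)) fun h => (hD' x h).trans (le_max_right _ _)⟩) ?_
  intro x hx
  have hopen : IsOpen ((P : Set ℝ) \ {x})ᶜ := (P.finite_toSet.sdiff).isClosed.isOpen_compl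
  obtain ⟨ε, hε, hball⟩ := Metric.nhds_basis_ball.mem_iff.1 (hopen.mem_nhds (x := x) (by simp))
  rw [Real.ball_eq_Ioo] at hball
  have hPx : ∀ s ∈ Ioo (x - ε) (x + ε), s ≠ x → s ∉ P := fun s hs hsx hsP =>
    hball hs ⟨hsP, hsx⟩
  have hleft : ∃ D, ∀ t ∈ Ioo (max (x - ε) 0) x, ‖deriv Γ t‖ ≤ D := by
    rcases hx.1.eq_or_lt with rfl | h0
    · exact ⟨0, fun t ht => absurd (ht.1.trans ht.2) (by simp)⟩
    · have hlt : max (x - ε) 0 < x := max_lt (by linarith) h0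
      refine exists_norm_deriv_le_Ioo hlt (hP _ _ hlt
        (fun s hs => ⟨(le_max_right _ _).trans hs.1, hs.2.trans hx.2⟩)
        (disjoint_left.2 fun s hs => hPx s ⟨(le_max_left _ _).trans_lt hs.1, ?_⟩ hs.2.ne))
      linarith [hs.2]
  have hright : ∃ D, ∀ t ∈ Ioo x (min (x + ε) 1), ‖deriv Γ t‖ ≤ D := by
    rcases hx.2.eq_or_lt with rfl | h0
    · exact ⟨0, fun t ht => absurd (ht.1.trans ht.2) (by simp)⟩
    · have hlt : x < min (x + ε) 1 := lt_min (by linarith) h0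
      refine exists_norm_deriv_le_Ioo hlt (hP _ _ hlt
        (fun s hs => ⟨hx.1.trans hs.1, hs.2.trans (min_le_right _ _)⟩)
        (disjoint_left.2 fun s hs => hPx s ⟨?_, hs.2.trans_le (min_le_left _ _)⟩ hs.1.ne'))
      linarith [hs.1]
  obtain ⟨D₁, hD₁⟩ := hleft
  obtain ⟨D₂, hD₂⟩ := hright
  -- At x, 0 and 1 the one-sided bounds say nothing about `deriv`, and at 0 and 1 it depends on Γ
  -- outside [0, 1]; these three values are simply added to the bound.
  refine ⟨Icc 0 1 ∩ Ioo (x - ε) (x + ε), inter_mem_nhdsWithin _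
    (Ioo_mem_nhds (by linarith) (by linarith)), |D₁| + |D₂| + ‖deriv Γ x‖ + ‖deriv Γ 0‖ +
    ‖deriv Γ 1‖, fun t ht => ?_⟩
  have n1 := abs_nonneg D₁
  have n2 := abs_nonneg D₂
  have n3 := norm_nonneg (deriv Γ x)
  have n4 := norm_nonneg (deriv Γ 0)
  have n5 := norm_nonneg (deriv Γ 1)
  rcases ht.1.1.eq_or_lt with h0 | h0
  · rw [← h0]; linarith
  rcases ht.1.2.eq_or_lt with h1 | h1
  · rw [h1]; linarith
  rcases lt_trichotomy t x with h | rfl | h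
  · linarith [hD₁ t ⟨max_lt ht.2.1 h0, h⟩, le_abs_self D₁]
  · linarith
  · linarith [hD₂ t ⟨h, lt_min ht.2.2 h1⟩, le_abs_self D₂]

theorem intervalIntegrable_deriv (hΓ : IsPiecewiseC1 Γ) :
    IntervalIntegrable (deriv Γ) volume 0 1 := by
  obtain ⟨D, -, hD⟩ := hΓ.exists_norm_deriv_le
  refine (intervalIntegrable_const (c := D)).mono_fun'
    (measurable_deriv Γ).aestronglyMeasurable ?_
  filter_upwards [ae_restrict_mem measurableSet_uIoc] with t ht
  rw [uIoc_of_le zero_le_one] at ht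
  exact hD t (Ioc_subset_Icc_self ht)

theorem intervalIntegrable_mul_deriv (hΓ : IsPiecewiseC1 Γ) {f : ℂ → ℂ} {U : Set ℂ}
    (hf : ContinuousOn f U) (hU : ∀ t ∈ Icc (0 : ℝ) 1, Γ t ∈ U) :
    IntervalIntegrable (fun t => f (Γ t) * deriv Γ t) volume 0 1 := by
  refine hΓ.intervalIntegrable_deriv.continuousOn_mul ?_
  rw [uIcc_of_le zero_le_one]
  exact hf.comp hΓ.1 hU

theorem integral_eq_zero_of_hasDerivAt (hΓ : IsPiecewiseC1 Γ) (hclosed : Γ 0 = Γ 1)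
    {f G : ℂ → ℂ} (hG : ∀ t ∈ Icc (0 : ℝ) 1, HasDerivAt G (f (Γ t)) (Γ t))
    (hf : IntervalIntegrable (fun t => f (Γ t) * deriv Γ t) volume 0 1) :
    ∫ t in (0 : ℝ)..1, f (Γ t) * deriv Γ t = 0 := by
  obtain ⟨P, hP⟩ := hΓ.exists_differentiableAt
  rw [integral_eq_of_hasDerivAt_off_countable_of_le (fun t => G (Γ t)) _ zero_le_one
    P.countable_toSet (fun t ht => (hG t ht).continuousAt.comp_continuousWithinAt (hΓ.1 t ht))
    (fun t ht => ?_) hf, hclosed, sub_self]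
  exact (hG t (Ioo_subset_Icc_self ht.1)).comp_of_eq t (hP t ht).hasDerivAt rfl

/-- A closed curve has index zero around a point of which it stays on one side. -/
theorem integral_inv_sub_eq_zero (hΓ : IsPiecewiseC1 Γ) (hclosed : Γ 0 = Γ 1) {p : ℂ} {σ : ℝ}
    (hp : ∀ t ∈ Icc (0 : ℝ) 1, 0 < σ * (p.im - (Γ t).im)) :
    ∫ t in (0 : ℝ)..1, 1 / (Γ t - p) * deriv Γ t = 0 := by
  have hne : ∀ t ∈ Icc (0 : ℝ) 1, Γ t - p ≠ 0 := fun t ht h => by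
    have := hp t ht
    rw [sub_eq_zero.1 h] at this
    simp at this
  -- Multiplication by σi turns the half-plane containing the curve, seen from p, into the right
  -- half-plane, where the logarithm is holomorphic.
  refine hΓ.integral_eq_zero_of_hasDerivAt hclosed (f := fun z => 1 / (z - p))
    (G := fun z => Complex.log (σ * I * (z - p))) (fun t ht => ?_) ?_
  · have hre : 0 < ((σ : ℂ) * I * (Γ t - p)).re := by
      have := hp t ht
      simp
      linarith
    have h1 : HasDerivAt (fun z : ℂ => (σ : ℂ) * I * (z - p)) (σ * I * 1) (Γ t) :=
      ((hasDerivAt_id _).sub_const p).const_mul _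
    refine (h1.clog (.inl hre)).congr_deriv ?_
    have hσ : (σ : ℂ) * I ≠ 0 := fun h => by simp [h] at hre
    rw [mul_div_mul_left _ _ hσ]
  · refine hΓ.intervalIntegrable_mul_deriv (f := fun z => 1 / (z - p)) (U := {z | z - p ≠ 0})
      ?_ hne
    exact continuousOn_const.div (by fun_prop) fun z hz => hz

end IsPiecewiseC1

/-- Cauchy's formula on the outside of a loop around `[a, b]`. -/
theorem IsLoopAround.integral_div_sub {a b : ℝ} (hab : a < b) {Γ : ℝ → ℂ}
    (hΓ : IsLoopAround a b Γ) {F : ℂ → ℂ} {L : ℂ} (hF : DifferentiableOn ℂ F (cutSet a b)ᶜ)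
    (hL : (fun z => F z - L) =O[Bornology.cobounded ℂ] fun z => z⁻¹) {p : ℂ}
    (hpJ : p ∉ cutSet a b) {σ : ℝ} (hp : ∀ t ∈ Icc (0 : ℝ) 1, 0 < σ * (p.im - (Γ t).im)) :
    ∫ t in (0 : ℝ)..1, F (Γ t) / (Γ t - p) * deriv Γ t = 2 * Real.pi * I * (L - F p) := by
  have hC := hΓ.piecewiseC1
  obtain ⟨G, hG, -⟩ := exists_primitive_dslope_sub hab hF hL hpJ
  have hne : ∀ t ∈ Icc (0 : ℝ) 1, Γ t ≠ p := fun t ht h => by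
    have := hp t ht
    rw [h] at this
    simp at this
  have hna : ∀ z ∉ cutSet a b, z - a ≠ 0 := fun z hz =>
    sub_ne_zero.2 (ne_of_notMem_cutSet hz ⟨le_rfl, hab.le⟩)
  have hmem : ∀ t ∈ Icc (0 : ℝ) 1, Γ t ∈ (cutSet a b)ᶜ \ {p} := fun t ht =>
    ⟨hΓ.avoids t ht, hne t ht⟩
  have hc1 : ContinuousOn (fun z : ℂ => 1 / (z - p)) ((cutSet a b)ᶜ \ {p}) :=
    continuousOn_const.div (by fun_prop) fun z hz => sub_ne_zero.2 hz.2
  have hc2 : ContinuousOn (fun z : ℂ => 1 / (z - a)) ((cutSet a b)ᶜ \ {p}) :=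
    continuousOn_const.div (by fun_prop) fun z hz => hna z hz.1
  have hc3 : ContinuousOn F ((cutSet a b)ᶜ \ {p}) := hF.continuousOn.mono sdiff_subset
  have hc4 : ContinuousOn (fun z => F z * (1 / (z - p))) ((cutSet a b)ᶜ \ {p}) := hc3.mul hc1
  have i1 := hC.intervalIntegrable_mul_deriv hc1 hmem
  have i2 := hC.intervalIntegrable_mul_deriv hc2 hmem
  have i4 := hC.intervalIntegrable_mul_deriv hc4 hmem
  have e1 := hC.integral_inv_sub_eq_zero hΓ.closed hp
  have e2 : ∫ t in (0 : ℝ)..1, 1 / (Γ t - a) * deriv Γ t = 2 * Real.pi * I := by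
    have h := hΓ.index_one a ⟨le_rfl, hab.le⟩
    have hpi : (2 * (Real.pi : ℂ) * I) ≠ 0 := Complex.two_pi_I_ne_zero
    simp only [one_div_mul_eq_div]
    field_simp at h
    rw [h]
  have e3 : ∫ t in (0 : ℝ)..1, (F (Γ t) / (Γ t - p) - F p / (Γ t - p) - (L - F p) / (Γ t - a)) *
      deriv Γ t = 0 := by
    refine hC.integral_eq_zero_of_hasDerivAt hΓ.closed
      (f := fun z => F z / (z - p) - F p / (z - p) - (L - F p) / (z - a))
      (fun t ht => hG _ (hΓ.avoids t ht) (hne t ht)) ?_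
    refine ((i4.sub (i1.const_mul (F p))).sub (i2.const_mul (L - F p))).congr fun t _ => ?_
    ring
  -- An exact part, plus a pole at p of index 0, plus a pole at a of index 1.
  have e5 : ∀ t, F (Γ t) / (Γ t - p) * deriv Γ t =
      (F (Γ t) / (Γ t - p) - F p / (Γ t - p) - (L - F p) / (Γ t - a)) * deriv Γ t +
      F p * (1 / (Γ t - p) * deriv Γ t) + (L - F p) * (1 / (Γ t - a) * deriv Γ t) := fun t => by
    ring
  have i3 : IntervalIntegrable (fun t => (F (Γ t) / (Γ t - p) - F p / (Γ t - p) -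
      (L - F p) / (Γ t - a)) * deriv Γ t) volume 0 1 := by
    refine ((i4.sub (i1.const_mul (F p))).sub (i2.const_mul (L - F p))).congr fun t _ => ?_
    ring
  simp only [e5]
  rw [intervalIntegral.integral_add (i3.add (i1.const_mul _)) (i2.const_mul _),
    intervalIntegral.integral_add i3 (i1.const_mul _), intervalIntegral.integral_const_mul,
    intervalIntegral.integral_const_mul, e1, e2, e3]
  ring

/-! ### Integrals along horizontal lines. -/

section Line

/-- The constant depends on A only through δ and R, so the bound is uniform when A runs along the
curve. -/
theorem one_add_abs_le_mul_norm_sub {δ R : ℝ} (hδ : 0 < δ) {A : ℂ} (hA : δ ≤ |A.im|)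
    (hR : ‖A‖ ≤ R) (y : ℝ) : 1 + |y| ≤ ((1 + R) / δ + 1) * ‖(y : ℂ) - A‖ := by
  have h1 : δ ≤ ‖(y : ℂ) - A‖ := by
    refine hA.trans ?_
    have := Complex.abs_im_le_norm ((y : ℂ) - A)
    simpa using this
  have h2 : |y| ≤ ‖(y : ℂ) - A‖ + ‖A‖ := by
    have := norm_le_norm_sub_add (y : ℂ) A
    simpa using this
  have h3 : (1 + R) ≤ (1 + R) / δ * ‖(y : ℂ) - A‖ := by
    rw [div_mul_eq_mul_div, le_div_iff₀ hδ]
    have : 0 ≤ R := (norm_nonneg _).trans hR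
    gcongr
  linarith

theorem norm_inv_sub_le {δ R : ℝ} (hδ : 0 < δ) {A : ℂ} (hA : δ ≤ |A.im|)
    (hR : ‖A‖ ≤ R) (y : ℝ) : ‖((y : ℂ) - A)⁻¹‖ ≤ ((1 + R) / δ + 1) * (1 + |y|)⁻¹ := by
  have h := one_add_abs_le_mul_norm_sub hδ hA hR y
  have h0 : 0 < 1 + |y| := by positivity
  have h1 : 0 < ‖(y : ℂ) - A‖ := by
    rw [norm_pos_iff]
    intro h2
    rw [h2, norm_zero, mul_zero] at h
    linarith
  rw [norm_inv, ← div_eq_mul_inv, le_div_iff₀ h0, inv_mul_le_iff₀ h1]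
  linarith

theorem integrable_inv_one_add_abs_sq : Integrable fun y : ℝ => ((1 + |y|)⁻¹) ^ 2 := by
  refine integrable_inv_one_add_sq.mono' (Continuous.aestronglyMeasurable ?_)
    (.of_forall fun y => ?_)
  · exact (Continuous.inv₀ (by fun_prop) fun y => by positivity).pow 2
  · rw [Real.norm_of_nonneg (by positivity), inv_pow]
    refine inv_anti₀ (by positivity) ?_
    nlinarith [abs_nonneg y, sq_abs y]

theorem ofReal_sub_ne_zero {A : ℂ} (hA : A.im ≠ 0) (y : ℝ) : (y : ℂ) - A ≠ 0 := fun h => hA (by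
  rw [← sub_eq_zero.1 h, Complex.ofReal_im])

theorem continuous_inv_ofReal_sub {A : ℂ} (hA : A.im ≠ 0) :
    Continuous fun y : ℝ => ((y : ℂ) - A)⁻¹ :=
  Continuous.inv₀ (by fun_prop) (ofReal_sub_ne_zero hA)

theorem integrable_inv_mul_inv {A B : ℂ} (hA : A.im ≠ 0) (hB : B.im ≠ 0) :
    Integrable fun y : ℝ => ((y : ℂ) - A)⁻¹ * ((y : ℂ) - B)⁻¹ := by
  refine (integrable_inv_one_add_abs_sq.const_mul
    (((1 + ‖A‖) / |A.im| + 1) * ((1 + ‖B‖) / |B.im| + 1))).mono'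
    ((continuous_inv_ofReal_sub hA).mul (continuous_inv_ofReal_sub hB)).aestronglyMeasurable
    (.of_forall fun y => ?_)
  rw [norm_mul]
  calc _ ≤ _ := mul_le_mul (norm_inv_sub_le (abs_pos.2 hA) le_rfl le_rfl y)
        (norm_inv_sub_le (abs_pos.2 hB) le_rfl le_rfl y) (norm_nonneg _) (by positivity)
    _ = _ := by ring

theorem inv_sub_inv_eq_mul {A B : ℂ} (hA : A.im ≠ 0) (hB : B.im ≠ 0) (y : ℝ) :
    ((y : ℂ) - A)⁻¹ - ((y : ℂ) - B)⁻¹ = (A - B) * (((y : ℂ) - A)⁻¹ * ((y : ℂ) - B)⁻¹) := by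
  have h1 := ofReal_sub_ne_zero hA y
  have h2 := ofReal_sub_ne_zero hB y
  field_simp
  ring

/-- For t > 0 the difference is log(s(1 - A/t)), with no branch correction because the factor t is
positive. The divergent log t drops out when two such primitives are subtracted. -/
theorem tendsto_log_mul_sub_sub_log {s : ℂ} (hs : s ∈ slitPlane) (A : ℂ) :
    Tendsto (fun t : ℝ => Complex.log (s * (t - A)) - Real.log t) atTop (𝓝 (Complex.log s)) := by
  have h1 : Tendsto (fun t : ℝ => s * (1 - A * ((t⁻¹ : ℝ) : ℂ))) atTop (𝓝 s) := by
    have h2 : Tendsto (fun t : ℝ => ((t⁻¹ : ℝ) : ℂ)) atTop (𝓝 ((0 : ℝ) : ℂ)) :=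
      (Complex.continuous_ofReal.tendsto 0).comp tendsto_inv_atTop_zero
    simpa using ((h2.const_mul A).const_sub 1).const_mul s
  have h3 : Tendsto (fun t : ℝ => Complex.log (s * (1 - A * ((t⁻¹ : ℝ) : ℂ)))) atTop
      (𝓝 (Complex.log s)) := h1.clog hs
  refine h3.congr' ?_
  filter_upwards [eventually_gt_atTop 0, h1.eventually_ne (slitPlane_ne_zero hs)] with t ht hne
  have hc : (t : ℂ) ≠ 0 := by exact_mod_cast ht.ne'
  rw [show s * ((t : ℂ) - A) = t * (s * (1 - A * ((t⁻¹ : ℝ) : ℂ))) by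
    push_cast; field_simp, Complex.log_ofReal_mul ht hne]
  ring

theorem sign_mul_I_mem_slitPlane {x : ℝ} (hx : x ≠ 0) : (Real.sign x : ℂ) * I ∈ slitPlane := by
  refine .inr ?_
  rcases lt_or_gt_of_ne hx with h | h
  · simp [Real.sign_of_neg h]
  · simp [Real.sign_of_pos h]

theorem log_sign_mul_I {x : ℝ} (hx : x ≠ 0) :
    Complex.log ((Real.sign x : ℂ) * I) = Real.sign x * (Real.pi / 2 * I) := by
  rcases lt_or_gt_of_ne hx with h | h
  · simp [Real.sign_of_neg h, Complex.log_neg_I]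
  · simp [Real.sign_of_pos h, Complex.log_I]

theorem integral_inv_sub_inv {A B : ℂ} (hA : A.im ≠ 0) (hB : B.im ≠ 0) :
    ∫ y : ℝ, (((y : ℂ) - A)⁻¹ - ((y : ℂ) - B)⁻¹) =
      Real.pi * I * (Real.sign A.im - Real.sign B.im) := by
  -- The factor sgn(Im C) i puts the whole line y - C in the right half-plane, so one branch of the
  -- logarithm serves from -∞ to ∞.
  have hderiv : ∀ {C : ℂ}, C.im ≠ 0 → ∀ y : ℝ,
      HasDerivAt (fun y : ℝ => Complex.log (Real.sign C.im * I * (y - C))) ((y : ℂ) - C)⁻¹ y := by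
    intro C hC y
    have hmem : (Real.sign C.im : ℂ) * I * (y - C) ∈ slitPlane := by
      refine .inl ?_
      rcases lt_or_gt_of_ne hC with h | h
      · simp [Real.sign_of_neg h, h]
      · simp [Real.sign_of_pos h, h]
    have h1 : HasDerivAt (fun z : ℂ => (Real.sign C.im : ℂ) * I * (z - C))
        (Real.sign C.im * I * 1) (y : ℂ) := ((hasDerivAt_id _).sub_const C).const_mul _
    refine (h1.clog hmem).comp_ofReal.congr_deriv ?_
    have h2 := slitPlane_ne_zero (sign_mul_I_mem_slitPlane hC)
    rw [mul_div_mul_left _ _ h2, one_div]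
  have htop : ∀ {C : ℂ}, C.im ≠ 0 → Tendsto (fun y : ℝ =>
      Complex.log (Real.sign C.im * I * (y - C)) - Real.log y) atTop
      (𝓝 (Real.sign C.im * (Real.pi / 2 * I))) := fun {C} hC => by
    rw [← log_sign_mul_I hC]
    exact tendsto_log_mul_sub_sub_log (sign_mul_I_mem_slitPlane hC) C
  -- At -∞, σ(-y - C) = (-σ)(y - (-C)): this is the limit at +∞ for -C, whose sign is opposite.
  have hbot : ∀ {C : ℂ}, C.im ≠ 0 → Tendsto (fun y : ℝ =>
      Complex.log (Real.sign C.im * I * (((-y : ℝ) : ℂ) - C)) - Real.log y) atTop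
      (𝓝 (-(Real.sign C.im * (Real.pi / 2 * I)))) := fun {C} hC => by
    have h := log_sign_mul_I (neg_ne_zero.2 hC)
    rw [Real.sign_neg] at h
    have h2 := tendsto_log_mul_sub_sub_log (sign_mul_I_mem_slitPlane (neg_ne_zero.2 hC)) (-C)
    rw [Real.sign_neg, h] at h2
    convert h2 using 2 with y
    · push_cast; ring_nf
    · push_cast; ring
  have hint : Integrable fun y : ℝ => ((y : ℂ) - A)⁻¹ - ((y : ℂ) - B)⁻¹ := by
    simp only [inv_sub_inv_eq_mul hA hB]
    exact (integrable_inv_mul_inv hA hB).const_mul _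
  have hT := (htop hA).sub (htop hB)
  have hB' := ((hbot hA).sub (hbot hB)).comp tendsto_neg_atBot_atTop
  rw [integral_of_hasDerivAt_of_tendsto (fun y => (hderiv hA y).sub (hderiv hB y)) hint
    (hB'.congr fun y => ?_) (hT.congr fun y => ?_)]
  · ring
  · simp
  · simp

theorem exists_norm_line_le {a b : ℝ} {F : ℂ → ℂ} {L : ℂ}
    (hF : DifferentiableOn ℂ F (cutSet a b)ᶜ)
    (hL : (fun z => F z - L) =O[Bornology.cobounded ℂ] fun z => z⁻¹) {w : ℂ} (hw : w.im ≠ 0) :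
    Continuous (fun y : ℝ => F (y + w)) ∧ ∃ C, 0 ≤ C ∧ ∀ y : ℝ, ‖F (y + w)‖ ≤ C := by
  have hline : ∀ y : ℝ, (y : ℂ) + w ∉ cutSet a b := fun y =>
    notMem_cutSet_of_im_ne_zero (by simpa using hw)
  have hcont : Continuous fun y : ℝ => F (y + w) :=
    hF.continuousOn.comp_continuous (by fun_prop) hline
  refine ⟨hcont, ?_⟩
  have hcob : Tendsto (fun y : ℝ => (y : ℂ) + w) (cocompact ℝ) (Bornology.cobounded ℂ) := by
    refine (tendsto_add_const_cobounded w).comp ?_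
    rw [Metric.cobounded_eq_cocompact]
    exact Complex.isometry_ofReal.isClosedEmbedding.tendsto_cocompact
  have h0 : Tendsto (fun y : ℝ => F (y + w) - L) (cocompact ℝ) (𝓝 0) :=
    (hL.trans_tendsto Filter.tendsto_inv₀_cobounded).comp hcob
  let g : ZeroAtInftyContinuousMap ℝ ℂ := ⟨⟨fun y => F (y + w) - L, hcont.sub continuous_const⟩, h0⟩
  obtain ⟨C, hC⟩ := g.isBounded_range.exists_norm_le
  have hC' : ∀ y : ℝ, ‖F (y + w) - L‖ ≤ C := fun y => hC _ ⟨y, rfl⟩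
  refine ⟨C + ‖L‖, add_nonneg ((norm_nonneg _).trans (hC' 0)) (norm_nonneg _), fun y => ?_⟩
  have := norm_add_le (F (y + w) - L) L
  rw [sub_add_cancel] at this
  linarith [hC' y]

/-- The integral of `F(ζ) / ((ζ - p) (ζ - q))` along a horizontal line missing `[a, b]`. -/
theorem integral_line_mul_inv_sub_inv {a b : ℝ} (hab : a < b) {F : ℂ → ℂ} {L : ℂ}
    (hF : DifferentiableOn ℂ F (cutSet a b)ᶜ)
    (hL : (fun z => F z - L) =O[Bornology.cobounded ℂ] fun z => z⁻¹) {w p q : ℂ} (hw : w.im ≠ 0)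
    (hp : p ∉ cutSet a b) (hq : q ∉ cutSet a b) (hpw : p.im - w.im ≠ 0) (hqw : q.im - w.im ≠ 0) :
    ∫ y : ℝ, F (y + w) * (((y + w : ℂ) - p)⁻¹ - ((y + w : ℂ) - q)⁻¹) =
      Real.pi * I * (F p * (Real.sign (p.im - w.im) - Real.sign (-w.im)) -
        F q * (Real.sign (q.im - w.im) - Real.sign (-w.im))) := by
  obtain ⟨hcont, C, hC0, hC⟩ := exists_norm_line_le hF hL hw
  obtain ⟨Gp, hGp, ℓp, hℓp⟩ := exists_primitive_dslope_sub hab hF hL hp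
  obtain ⟨Gq, hGq, ℓq, hℓq⟩ := exists_primitive_dslope_sub hab hF hL hq
  have hline : ∀ y : ℝ, (y : ℂ) + w ∉ cutSet a b := fun y =>
    notMem_cutSet_of_im_ne_zero (by simpa using hw)
  have hP : (p - w).im ≠ 0 := by simpa using hpw
  have hQ : (q - w).im ≠ 0 := by simpa using hqw
  have hA : ((a : ℂ) - w).im ≠ 0 := by simpa using hw
  have hsub : ∀ (y : ℝ) (r : ℂ), (y + w : ℂ) - r = y - (r - w) := fun y r => by ring
  have i0 : Integrable fun y : ℝ => F (y + w) * (((y + w : ℂ) - p)⁻¹ - ((y + w : ℂ) - q)⁻¹) := by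
    simp only [hsub, inv_sub_inv_eq_mul hP hQ]
    exact ((integrable_inv_mul_inv hP hQ).const_mul _).bdd_mul hcont.aestronglyMeasurable
      (.of_forall hC)
  have i1 : ∀ {r : ℂ}, (r - w).im ≠ 0 →
      Integrable fun y : ℝ => ((y + w : ℂ) - r)⁻¹ - ((y + w : ℂ) - a)⁻¹ := fun {r} hr => by
    simp only [hsub, inv_sub_inv_eq_mul hr hA]
    exact (integrable_inv_mul_inv hr hA).const_mul _
  have e1 : ∀ {r : ℂ}, (r - w).im ≠ 0 →
      ∫ y : ℝ, (((y + w : ℂ) - r)⁻¹ - ((y + w : ℂ) - a)⁻¹) =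
        Real.pi * I * (Real.sign (r.im - w.im) - Real.sign (-w.im)) := fun {r} hr => by
    simp only [hsub]
    rw [integral_inv_sub_inv hr hA]
    simp
  set D : ℝ → ℂ := fun y =>
    (F (y + w) / (y + w - p) - F p / (y + w - p) - (L - F p) / (y + w - a)) -
    (F (y + w) / (y + w - q) - F q / (y + w - q) - (L - F q) / (y + w - a)) with hD
  -- Each pole is paired with one at a, making every difference integrable; the two added terms (L -
  -- F(p))/(z - a) and (L - F(q))/(z - a) are absorbed in D.
  have e2 : ∀ y : ℝ, F (y + w) * (((y + w : ℂ) - p)⁻¹ - ((y + w : ℂ) - q)⁻¹) =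
      D y + F p * (((y + w : ℂ) - p)⁻¹ - ((y + w : ℂ) - a)⁻¹) -
        F q * (((y + w : ℂ) - q)⁻¹ - ((y + w : ℂ) - a)⁻¹) := fun y => by
    simp only [hD]; ring
  have i2 : Integrable D := by
    refine ((i0.sub ((i1 hP).const_mul (F p))).add ((i1 hQ).const_mul (F q))).congr
      (.of_forall fun y => ?_)
    simp only [Pi.add_apply, Pi.sub_apply]
    rw [e2]; ring
  have hcob : ∀ {l : Filter ℝ}, l ≤ cocompact ℝ →
      Tendsto (fun y : ℝ => (y : ℂ) + w) l (Bornology.cobounded ℂ) := fun hl => by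
    refine (tendsto_add_const_cobounded w).comp ?_
    rw [Metric.cobounded_eq_cocompact]
    exact Complex.isometry_ofReal.isClosedEmbedding.tendsto_cocompact.mono_left hl
  -- Both ends of the line go to infinity, where each primitive has a single limit, so the exact
  -- part contributes nothing.
  have e3 : ∫ y, D y = 0 := by
    have hlim := fun {l : Filter ℝ} (hl : l ≤ cocompact ℝ) =>
      (hℓp.comp (hcob hl)).sub (hℓq.comp (hcob hl))
    rw [integral_of_hasDerivAt_of_tendsto (f := fun y : ℝ => Gp (y + w) - Gq (y + w))
      (fun y => ?_) i2 (hlim atBot_le_cocompact) (hlim atTop_le_cocompact), sub_self]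
    have hr : HasDerivAt (fun y : ℝ => (y : ℂ) + w) 1 y :=
      ((hasDerivAt_id (y : ℂ)).add_const w).comp_ofReal
    have hne : ∀ {r : ℂ}, (r - w).im ≠ 0 → (y : ℂ) + w ≠ r := fun {r} hr h => by
      have := ofReal_sub_ne_zero hr y
      rw [← hsub, h, sub_self] at this
      exact this rfl
    have hd1 := (hGp _ (hline y) (hne hP)).comp y hr
    have hd2 := (hGq _ (hline y) (hne hQ)).comp y hr
    simp only [mul_one] at hd1 hd2
    exact hd1.sub hd2
  simp only [e2]
  have i3 : Integrable fun y : ℝ => D y + F p * (((y + w : ℂ) - p)⁻¹ - ((y + w : ℂ) - a)⁻¹) :=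
    i2.add ((i1 hP).const_mul _)
  rw [integral_sub i3 ((i1 hQ).const_mul _), integral_add i2 ((i1 hP).const_mul _), integral_const_mul, integral_const_mul, e1 hP, e1 hQ, e3]
  ring

end Line

/-! ### Which side of a shifted line a point lies on. -/

theorem Real.sign_add_half_of_abs_lt {x c : ℝ} (h : |x| < |c| / 2) :
    Real.sign (x + c / 2) = Real.sign c := by
  obtain ⟨h1, h2⟩ := abs_lt.1 h
  rcases lt_trichotomy c 0 with hc | rfl | hc
  · rw [abs_of_neg hc] at h1 h2
    rw [Real.sign_of_neg hc, Real.sign_of_neg (by linarith)]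
  · simp at h1 h2; linarith
  · rw [abs_of_pos hc] at h1 h2
    rw [Real.sign_of_pos hc, Real.sign_of_pos (by linarith)]

theorem Real.sign_sub_half_of_abs_lt {x c : ℝ} (h : |x| < |c| / 2) :
    Real.sign (x - c / 2) = -Real.sign c := by
  rw [← Real.sign_neg, ← Real.sign_add_half_of_abs_lt (x := x) (c := -c) (by rwa [abs_neg])]
  congr 1; ring

theorem Real.sign_half (c : ℝ) : Real.sign (c / 2) = Real.sign c := by
  rcases lt_trichotomy c 0 with hc | rfl | hc
  · rw [Real.sign_of_neg hc, Real.sign_of_neg (by linarith)]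
  · simp
  · rw [Real.sign_of_pos hc, Real.sign_of_pos (by linarith)]

theorem Real.sign_mul_sign_of_ne_zero {c : ℝ} (hc : c ≠ 0) : Real.sign c * Real.sign c = 1 := by
  rcases lt_or_gt_of_ne hc with h | h
  · simp [Real.sign_of_neg h]
  · simp [Real.sign_of_pos h]

/-! ### The factors A and B and their products. -/

/-- What is used of the solution of the Riemann--Hilbert problem and of the loop. -/
structure LoopData {N : ℕ} (a b : ℝ) (χ : ℂ → Matrix (Fin N) (Fin N) ℂ) (c : Fin N → ℝ)
    (Γ : ℝ → ℂ) : Prop where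
  lt : a < b
  holomorphic : ∀ i j, DifferentiableOn ℂ (fun z => χ z i j) (cutSet a b)ᶜ
  infinity : ∀ i j, (fun z => χ z i j - (1 : Matrix (Fin N) (Fin N) ℂ) i j)
      =O[Bornology.cobounded ℂ] fun z => z⁻¹
  holomorphic_inv : ∀ i j, DifferentiableOn ℂ (fun z => (χ z)⁻¹ i j) (cutSet a b)ᶜ
  infinity_inv : ∀ i j, (fun z => (χ z)⁻¹ i j - (1 : Matrix (Fin N) (Fin N) ℂ) i j)
      =O[Bornology.cobounded ℂ] fun z => z⁻¹
  inv_mul : ∀ z ∉ cutSet a b, (χ z)⁻¹ * χ z = 1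
  loop : IsLoopAround a b Γ
  ne_zero : ∀ k, c k ≠ 0
  small : ∀ t ∈ Icc (0 : ℝ) 1, ∀ k, |(Γ t).im| < |c k| / 2

section Factors

variable {N : ℕ}

/-- The curve, extended from `[0, 1]` to the line. -/
def extendCurve (Γ : ℝ → ℂ) (t : ℝ) : ℂ := Γ (projIcc 0 1 zero_le_one t)

/-- The speed of the curve, extended by zero from `[0, 1]` to the line. -/
def extendSpeed (Γ : ℝ → ℂ) : ℝ → ℂ := indicator (Icc 0 1) (deriv Γ)

/-- The factor `L²(ℝ) → L²(Γ)` of the two operators. -/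
def factorA (χ : ℂ → Matrix (Fin N) (Fin N) ℂ) (c : Fin N → ℝ) (γ : Fin N → ℂ)
    (v : Fin N → Fin N) (Γ : ℝ → ℂ) (k l : Fin N) (s y : ℝ) : ℂ :=
  -(γ k / (2 * I * Real.pi)) *
    (∑ m, (χ (extendCurve Γ s))⁻¹ (v k) m * χ (y + -(I * c l / 2)) m l) *
    ((y : ℂ) - (extendCurve Γ s + I * c l / 2))⁻¹

/-- The factor `L²(Γ) → L²(ℝ)` of the two operators. -/
def factorB (c : Fin N → ℝ) (Γ : ℝ → ℂ) (k : Fin N) (y s : ℝ) : ℂ :=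
  -(Real.sign (c k) / (2 * I * Real.pi)) * ((y : ℂ) - (extendCurve Γ s - I * c k / 2))⁻¹ *
    extendSpeed Γ s

theorem extendCurve_of_mem {Γ : ℝ → ℂ} {t : ℝ} (ht : t ∈ Icc (0 : ℝ) 1) :
    extendCurve Γ t = Γ t := by
  rw [extendCurve, projIcc_of_mem _ ht]

theorem extendSpeed_of_mem {Γ : ℝ → ℂ} {t : ℝ} (ht : t ∈ Icc (0 : ℝ) 1) :
    extendSpeed Γ t = deriv Γ t := indicator_of_mem ht _

namespace LoopData

variable {a b : ℝ} {χ : ℂ → Matrix (Fin N) (Fin N) ℂ} {c : Fin N → ℝ} {Γ : ℝ → ℂ}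

theorem continuous_extendCurve (h : LoopData a b χ c Γ) : Continuous (extendCurve Γ) :=
  h.loop.piecewiseC1.1.comp_continuous (by fun_prop) fun t => (projIcc 0 1 zero_le_one t).2

theorem abs_im_extendCurve_lt (h : LoopData a b χ c Γ) (t : ℝ) (k : Fin N) :
    |(extendCurve Γ t).im| < |c k| / 2 := h.small _ (projIcc 0 1 zero_le_one t).2 k

theorem im_add_ne_zero (h : LoopData a b χ c Γ) (t : ℝ) (k : Fin N) :
    (extendCurve Γ t + I * c k / 2).im ≠ 0 := by
  have h1 := Real.sign_add_half_of_abs_lt (h.abs_im_extendCurve_lt t k)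
  intro h2
  have h3 : (extendCurve Γ t + I * c k / 2).im = (extendCurve Γ t).im + c k / 2 := by simp
  rw [← h3, h2, Real.sign_zero] at h1
  exact h.ne_zero k (Real.sign_eq_zero_iff.1 h1.symm)

theorem im_sub_ne_zero (h : LoopData a b χ c Γ) (t : ℝ) (k : Fin N) :
    (extendCurve Γ t - I * c k / 2).im ≠ 0 := by
  have h1 := Real.sign_sub_half_of_abs_lt (h.abs_im_extendCurve_lt t k)
  intro h2
  have h3 : (extendCurve Γ t - I * c k / 2).im = (extendCurve Γ t).im - c k / 2 := by simp
  rw [← h3, h2, Real.sign_zero, zero_eq_neg] at h1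
  exact h.ne_zero k (Real.sign_eq_zero_iff.1 h1)

theorem shift_im_ne_zero (h : LoopData a b χ c Γ) (l : Fin N) : (-(I * c l / 2) : ℂ).im ≠ 0 := by
  simpa using h.ne_zero l

theorem continuous_inv_extendCurve (h : LoopData a b χ c Γ) (i j : Fin N) :
    Continuous fun s => (χ (extendCurve Γ s))⁻¹ i j :=
  (h.holomorphic_inv i j).continuousOn.comp_continuous h.continuous_extendCurve
    fun t => h.loop.avoids _ (projIcc 0 1 zero_le_one t).2

theorem continuous_line (h : LoopData a b χ c Γ) (l i j : Fin N) :
    Continuous fun y : ℝ => χ (y + -(I * c l / 2)) i j :=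
  (exists_norm_line_le (h.holomorphic i j) (h.infinity i j) (h.shift_im_ne_zero l)).1

theorem continuous_factorA (h : LoopData a b χ c Γ) (γ : Fin N → ℂ) (v : Fin N → Fin N)
    (k l : Fin N) : Continuous fun p : ℝ × ℝ => factorA χ c γ v Γ k l p.1 p.2 := by
  unfold factorA
  refine (continuous_const.mul (continuous_finsetSum _ fun m _ => ?_)).mul
    (Continuous.inv₀ ?_ fun p => ofReal_sub_ne_zero (h.im_add_ne_zero _ _) _)
  · exact ((h.continuous_inv_extendCurve (v k) m).comp continuous_fst).mul
      ((h.continuous_line l m l).comp continuous_snd)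
  · have := h.continuous_extendCurve
    fun_prop

theorem measurable_extendSpeed : Measurable (extendSpeed Γ) :=
  (measurable_deriv Γ).indicator measurableSet_Icc

theorem continuous_inv_sub (h : LoopData a b χ c Γ) (k : Fin N) :
    Continuous fun p : ℝ × ℝ => ((p.1 : ℂ) - (extendCurve Γ p.2 - I * c k / 2))⁻¹ := by
  have := h.continuous_extendCurve
  exact Continuous.inv₀ (by fun_prop) fun p => ofReal_sub_ne_zero (h.im_sub_ne_zero _ _) _

theorem stronglyMeasurable_factorB (h : LoopData a b χ c Γ) (k : Fin N) :
    StronglyMeasurable fun p : ℝ × ℝ => factorB c Γ k p.1 p.2 := by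
  unfold factorB
  exact (continuous_const.mul (h.continuous_inv_sub k)).stronglyMeasurable.mul
    (measurable_extendSpeed.comp measurable_snd).stronglyMeasurable

/-- By compactness the strict strip condition has a uniform gap, which keeps the Cauchy kernels away
from their poles. -/
theorem exists_le_sub_abs_im (h : LoopData a b χ c Γ) (k : Fin N) :
    ∃ δ, 0 < δ ∧ ∀ t, δ ≤ |c k| / 2 - |(extendCurve Γ t).im| := by
  have hcont : ContinuousOn (fun t => |c k| / 2 - |(Γ t).im|) (Icc 0 1) :=
    continuousOn_const.sub (Complex.continuous_im.comp_continuousOn h.loop.piecewiseC1.1).abs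
  obtain ⟨t₀, ht₀, hmin⟩ := isCompact_Icc.exists_isMinOn (nonempty_Icc.2 zero_le_one) hcont
  exact ⟨_, sub_pos.2 (h.small t₀ ht₀ k), fun t => hmin (projIcc 0 1 zero_le_one t).2⟩

theorem exists_norm_curve_le (h : LoopData a b χ c Γ) : ∃ R, ∀ t, ‖extendCurve Γ t‖ ≤ R := by
  obtain ⟨R, hR⟩ := isCompact_Icc.exists_bound_of_continuousOn h.loop.piecewiseC1.1
  exact ⟨R, fun t => hR _ (projIcc 0 1 zero_le_one t).2⟩

theorem exists_norm_inv_add_le (h : LoopData a b χ c Γ) (k : Fin N) :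
    ∃ C, 0 ≤ C ∧ ∀ s y : ℝ, ‖((y : ℂ) - (extendCurve Γ s + I * c k / 2))⁻¹‖ ≤ C * (1 + |y|)⁻¹ ∧
      ‖((y : ℂ) - (extendCurve Γ s - I * c k / 2))⁻¹‖ ≤ C * (1 + |y|)⁻¹ := by
  obtain ⟨δ, hδ, hδle⟩ := h.exists_le_sub_abs_im k
  obtain ⟨R, hR⟩ := h.exists_norm_curve_le
  have hR0 : 0 ≤ R := (norm_nonneg _).trans (hR 0)
  have hn : ‖I * (c k : ℂ) / 2‖ = |c k| / 2 := by simp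
  refine ⟨(1 + (R + |c k| / 2)) / δ + 1, by positivity, fun s y => ⟨?_, ?_⟩⟩
  · refine norm_inv_sub_le hδ ?_ ((norm_add_le _ _).trans (by rw [hn]; gcongr; exact hR s)) y
    refine (hδle s).trans ?_
    have h3 : (extendCurve Γ s + I * c k / 2).im = (extendCurve Γ s).im + c k / 2 := by simp
    have h4 : |c k / 2| = |c k| / 2 := by rw [abs_div, abs_two]
    have h5 := abs_sub_abs_le_abs_sub (c k / 2) (-(extendCurve Γ s).im)
    rw [abs_neg, sub_neg_eq_add, h4, add_comm (c k / 2)] at h5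
    rwa [h3]
  · refine norm_inv_sub_le hδ ?_ ((norm_sub_le _ _).trans (by rw [hn]; gcongr; exact hR s)) y
    refine (hδle s).trans ?_
    have h3 : (extendCurve Γ s - I * c k / 2).im = (extendCurve Γ s).im - c k / 2 := by simp
    have h4 : |c k / 2| = |c k| / 2 := by rw [abs_div, abs_two]
    have h5 := abs_sub_abs_le_abs_sub (c k / 2) (extendCurve Γ s).im
    rw [h4, abs_sub_comm] at h5
    rwa [h3]

theorem exists_norm_factorA_le (h : LoopData a b χ c Γ) (γ : Fin N → ℂ) (v : Fin N → Fin N)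
    (k l : Fin N) : ∃ C, 0 ≤ C ∧ ∀ s y, ‖factorA χ c γ v Γ k l s y‖ ≤ C * (1 + |y|)⁻¹ := by
  have h1 : ∀ m, ∃ C, 0 ≤ C ∧ ∀ s, ‖(χ (extendCurve Γ s))⁻¹ (v k) m‖ ≤ C := fun m => by
    obtain ⟨C, hC⟩ := isCompact_Icc.exists_bound_of_continuousOn (s := Icc (0 : ℝ) 1)
      ((h.holomorphic_inv (v k) m).continuousOn.comp h.loop.piecewiseC1.1
        fun t ht => h.loop.avoids t ht)
    have hC' : ∀ s, ‖(χ (extendCurve Γ s))⁻¹ (v k) m‖ ≤ C :=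
      fun s => hC _ (projIcc 0 1 zero_le_one s).2
    exact ⟨C, (norm_nonneg _).trans (hC' 0), hC'⟩
  choose C₁ hC₁0 hC₁ using h1
  choose C₂ hC₂0 hC₂ using fun m =>
    (exists_norm_line_le (h.holomorphic m l) (h.infinity m l) (h.shift_im_ne_zero l)).2
  obtain ⟨C₃, hC₃0, hC₃⟩ := h.exists_norm_inv_add_le l
  have hS : 0 ≤ ∑ m, C₁ m * C₂ m := Finset.sum_nonneg fun m _ => mul_nonneg (hC₁0 m) (hC₂0 m)
  refine ⟨‖-(γ k / (2 * I * Real.pi))‖ * (∑ m, C₁ m * C₂ m) * C₃, by positivity, fun s y => ?_⟩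
  · have hsum : ‖∑ m, (χ (extendCurve Γ s))⁻¹ (v k) m * χ (y + -(I * c l / 2)) m l‖
        ≤ ∑ m, C₁ m * C₂ m := norm_sum_le_of_le _ fun m _ => by
      rw [norm_mul]
      exact mul_le_mul (hC₁ m s) (hC₂ m y) (norm_nonneg _) (hC₁0 m)
    rw [factorA, norm_mul, norm_mul, mul_assoc _ C₃]
    have := (hC₃ s y).1
    gcongr

theorem exists_norm_factorB_le (h : LoopData a b χ c Γ) (k : Fin N) :
    ∃ C, 0 ≤ C ∧ ∀ y s, ‖factorB c Γ k y s‖ ≤ C * (1 + |y|)⁻¹ := by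
  obtain ⟨C, hC0, hC⟩ := h.exists_norm_inv_add_le k
  obtain ⟨D, hD0, hD⟩ := h.loop.piecewiseC1.exists_norm_deriv_le
  refine ⟨‖-((Real.sign (c k) : ℂ) / (2 * I * Real.pi))‖ * C * D, by positivity, fun y s => ?_⟩
  have hs : ‖extendSpeed Γ s‖ ≤ D := by
    by_cases hs : s ∈ Icc (0 : ℝ) 1
    · rw [extendSpeed_of_mem hs]; exact hD s hs
    · rw [extendSpeed, indicator_of_notMem hs, norm_zero]; exact hD0
  rw [factorB, norm_mul, norm_mul, mul_right_comm _ D, mul_assoc _ C]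
  have := (hC s y).2
  gcongr

theorem exists_kernelFactors (h : LoopData a b χ c Γ) (γ : Fin N → ℂ) (v : Fin N → Fin N) :
    ∃ C, 0 ≤ C ∧ KernelFactors (volume.restrict (Icc (0 : ℝ) 1)) volume (factorA χ c γ v Γ)
      (factorB c Γ) fun y => C * (1 + |y|)⁻¹ := by
  choose CA hCA0 hCA using h.exists_norm_factorA_le γ v
  choose CB hCB0 hCB using h.exists_norm_factorB_le
  obtain ⟨C₁, hC₁⟩ := Finite.exists_le fun p : Fin N × Fin N => CA p.1 p.2
  obtain ⟨C₂, hC₂⟩ := Finite.exists_le CB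
  have hpos : ∀ y : ℝ, 0 ≤ (1 + |y|)⁻¹ := fun y => by positivity
  refine ⟨max 0 (max C₁ C₂), le_max_left _ _, ⟨fun k l =>
    (h.continuous_factorA γ v k l).stronglyMeasurable, h.stronglyMeasurable_factorB,
    fun k l s y => (hCA k l s y).trans (mul_le_mul_of_nonneg_right ?_ (hpos y)),
    fun k y s => (hCB k y s).trans (mul_le_mul_of_nonneg_right ?_ (hpos y)), ?_⟩⟩
  · exact (hC₁ (k, l)).trans ((le_max_left _ _).trans (le_max_right _ _))
  · exact (hC₂ k).trans ((le_max_right _ _).trans (le_max_right _ _))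
  · simp only [mul_pow]
    exact integrable_inv_one_add_abs_sq.const_mul _

/-- The poles of both factors stay off the real line, so dominated convergence applies on all of ℝ²,
including where the quotient defining N degenerates. -/
theorem continuous_kernelBA (h : LoopData a b χ c Γ) (γ : Fin N → ℂ) (v : Fin N → Fin N)
    (k l : Fin N) : Continuous fun p : ℝ × ℝ =>
      kernelBA (volume.restrict (Icc (0 : ℝ) 1)) (factorA χ c γ v Γ) (factorB c Γ) k l p.1 p.2 := by
  obtain ⟨C, hC0, hF⟩ := h.exists_kernelFactors γ v
  unfold kernelBA
  have hle : ∀ y : ℝ, C * (1 + |y|)⁻¹ ≤ C := fun y =>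
    mul_le_of_le_one_right hC0 (inv_le_one_of_one_le₀ (by linarith [abs_nonneg y]))
  refine continuous_of_dominated (bound := fun _ => C * C) (fun p => ?_) (fun p => ?_)
    (integrable_const _) (.of_forall fun s => ?_)
  · exact (((hF.measurable_right k).comp_measurable (g := fun s => (p.1, s)) (by fun_prop)).mul
      ((hF.measurable_left k l).comp_measurable (g := fun s => (s, p.2))
        (by fun_prop))).aestronglyMeasurable
  · refine .of_forall fun s => ?_
    rw [norm_mul]
    exact mul_le_mul ((hF.norm_right_le k _ _).trans (hle _))
      ((hF.norm_left_le k l _ _).trans (hle _)) (norm_nonneg _) hC0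
  · have c1 : Continuous fun p : ℝ × ℝ => factorA χ c γ v Γ k l s p.2 :=
      Continuous.comp (g := fun q : ℝ × ℝ => factorA χ c γ v Γ k l q.1 q.2)
        (f := fun p : ℝ × ℝ => (s, p.2)) (h.continuous_factorA γ v k l) (by fun_prop)
    have c2 : Continuous fun p : ℝ × ℝ =>
        ((p.1 : ℂ) - (extendCurve Γ s - I * c k / 2))⁻¹ :=
      Continuous.comp (g := fun q : ℝ × ℝ => ((q.1 : ℂ) - (extendCurve Γ q.2 - I * c k / 2))⁻¹)
        (f := fun p : ℝ × ℝ => (p.1, s)) (h.continuous_inv_sub k) (by fun_prop)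
    have c3 : Continuous fun p : ℝ × ℝ => factorB c Γ k p.1 s := by
      unfold factorB
      exact (continuous_const.mul c2).mul continuous_const
    exact c3.mul c1

/-- With ζ = y - ic_ℓ/2 the integral runs along a line having the cut and Γ(s) on one side and p =
Γ(t) - ic_ℓ on the other. The contribution of Γ(s) cancels and the residue at p is left. -/
theorem kernelAB_eq (h : LoopData a b χ c Γ) (γ : Fin N → ℂ) (v : Fin N → Fin N)
    (k l : Fin N) {s t : ℝ} (hs : s ∈ Icc (0 : ℝ) 1) (ht : t ∈ Icc (0 : ℝ) 1) :
    kernelAB volume (factorA χ c γ v Γ) (factorB c Γ) k l s t =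
      pullbackKernel Γ (kernelM χ c γ v) k l s t := by
  set w : ℂ := -(I * c l / 2) with hw
  set p : ℂ := Γ t - I * c l with hp
  have hwim : w.im = -(c l / 2) := by simp [hw]
  have hpim : p.im = (Γ t).im - c l := by simp [hp]
  have hcl := h.ne_zero l
  have hw0 : w.im ≠ 0 := h.shift_im_ne_zero l
  have hs1 : Real.sign (p.im - w.im) = -Real.sign (c l) := by
    rw [← Real.sign_sub_half_of_abs_lt (h.small t ht l), hpim, hwim]
    congr 1; ring
  have hs2 : Real.sign ((Γ s).im - w.im) = Real.sign (c l) := by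
    rw [← Real.sign_add_half_of_abs_lt (h.small s hs l), hwim]
    congr 1; ring
  have hs3 : Real.sign (-w.im) = Real.sign (c l) := by rw [hwim, neg_neg, Real.sign_half]
  have hsne : Real.sign (c l) ≠ 0 := fun h0 => hcl (Real.sign_eq_zero_iff.1 h0)
  have hpw : p.im - w.im ≠ 0 := fun h0 => by
    rw [h0, Real.sign_zero, zero_eq_neg] at hs1; exact hsne hs1
  have hqw : (Γ s).im - w.im ≠ 0 := fun h0 => by
    rw [h0, Real.sign_zero] at hs2; exact hsne hs2.symm
  have hpim0 : p.im ≠ 0 := fun h0 => by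
    have := h.small t ht l
    have h1 : (Γ t).im = c l := by linarith
    rw [h1] at this
    linarith [abs_nonneg (c l)]
  have hsp : Γ s - p ≠ 0 := fun h0 => by
    rw [sub_eq_zero.1 h0, hs1] at hs2
    exact hsne (by linarith)
  have hint : ∀ m, ∫ y : ℝ, χ (y + w) m l * (((y + w : ℂ) - p)⁻¹ - ((y + w : ℂ) - Γ s)⁻¹) =
      -(2 * Real.pi * I * Real.sign (c l)) * χ p m l := fun m => by
    rw [integral_line_mul_inv_sub_inv h.lt (h.holomorphic m l) (h.infinity m l) hw0
      (notMem_cutSet_of_im_ne_zero hpim0) (h.loop.avoids s hs) hpw hqw, hs1, hs2, hs3]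
    push_cast
    ring
  have hi : ∀ m, Integrable fun y : ℝ =>
      χ (y + w) m l * (((y + w : ℂ) - p)⁻¹ - ((y + w : ℂ) - Γ s)⁻¹) := fun m => by
    obtain ⟨hcont, C, -, hC⟩ := exists_norm_line_le (h.holomorphic m l) (h.infinity m l) hw0
    have hP : (p - w).im ≠ 0 := by simpa using hpw
    have hQ : (Γ s - w).im ≠ 0 := by simpa using hqw
    have hsub : ∀ (y : ℝ) (r : ℂ), (y + w : ℂ) - r = y - (r - w) := fun y r => by ring
    simp only [hsub, inv_sub_inv_eq_mul hP hQ]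
    exact ((integrable_inv_mul_inv hP hQ).const_mul _).bdd_mul hcont.aestronglyMeasurable
      (.of_forall hC)
  have hpi : (2 * I * (Real.pi : ℂ)) ≠ 0 := by
    simp [Real.pi_ne_zero]
  have hpt : ∀ y : ℝ, factorA χ c γ v Γ k l s y * factorB c Γ l y t =
      -(γ k / (2 * I * Real.pi) * (Real.sign (c l) / (2 * I * Real.pi)) * deriv Γ t / (Γ s - p)) *
        ∑ m, (χ (Γ s))⁻¹ (v k) m *
          (χ (y + w) m l * (((y + w : ℂ) - p)⁻¹ - ((y + w : ℂ) - Γ s)⁻¹)) := fun y => by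
    have e1 : (y : ℂ) - (Γ s + I * c l / 2) = y + w - Γ s := by rw [hw]; ring
    have e2 : (y : ℂ) - (Γ t - I * c l / 2) = y + w - p := by rw [hw, hp]; ring
    have n1 : (y : ℂ) + w - Γ s ≠ 0 := fun h0 => hqw (by
      rw [← sub_eq_zero.1 h0]; simp)
    have n2 : (y : ℂ) + w - p ≠ 0 := fun h0 => hpw (by
      rw [← sub_eq_zero.1 h0]; simp)
    have e3 : ((y : ℂ) + w - p)⁻¹ - ((y : ℂ) + w - Γ s)⁻¹ =
        -(Γ s - p) * (((y : ℂ) + w - Γ s)⁻¹ * ((y : ℂ) + w - p)⁻¹) := by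
      field_simp; ring
    rw [factorA, factorB, extendCurve_of_mem hs, extendCurve_of_mem ht, extendSpeed_of_mem ht, e1,
      e2, e3]
    simp only [← mul_assoc, ← hw]
    rw [← Finset.sum_mul, ← Finset.sum_mul, ← Finset.sum_mul]
    generalize ∑ m, (χ (Γ s))⁻¹ (v k) m * χ (y + w) m l = S
    field_simp
  rw [kernelAB]
  simp only [hpt]
  rw [integral_const_mul, integral_finsetSum _ fun m _ => (hi m).const_mul _]
  simp only [integral_const_mul, hint]
  have hM : ∑ m, (χ (Γ s))⁻¹ (v k) m * (-(2 * Real.pi * I * Real.sign (c l)) * χ p m l) =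
      -(2 * Real.pi * I * Real.sign (c l)) * ((χ (Γ s))⁻¹ * χ p) (v k) l := by
    rw [Matrix.mul_apply, Finset.mul_sum]
    exact Finset.sum_congr rfl fun m _ => by ring
  have hss : (Real.sign (c l) : ℂ) * Real.sign (c l) = 1 := by
    exact_mod_cast Real.sign_mul_sign_of_ne_zero hcl
  rw [hM, pullbackKernel, kernelM, ← hp,
    show Γ s - Γ t + I * (c l : ℂ) = Γ s - p by rw [hp]; ring]
  field_simp
  -- The sign in B cancels the one telling on which side of the line p lies.
  linear_combination (γ k * ((χ (Γ s))⁻¹ * χ p) (v k) l * deriv Γ t) * hss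

/-- Off the diagonal the kernel of `B A` is computed by residues outside of the loop. -/
theorem kernelBA_of_ne (h : LoopData a b χ c Γ) (γ : Fin N → ℂ) (v : Fin N → Fin N)
    (k l : Fin N) {x y : ℝ} (hxy : (x : ℂ) - y + I * ((c k : ℂ) + c l) / 2 ≠ 0) :
    kernelBA (volume.restrict (Icc (0 : ℝ) 1)) (factorA χ c γ v Γ) (factorB c Γ) k l x y =
      Real.sign (c k) * γ k *
      (1 - (χ (x + I * (c k : ℂ) / 2))⁻¹ * χ (y - I * (c l : ℂ) / 2)) (v k) l /
      (2 * I * (Real.pi : ℂ) * ((x : ℂ) - y + I * ((c k : ℂ) + c l) / 2)) := by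
  set z : ℂ := x + I * c k / 2 with hz
  set w : ℂ := y - I * c l / 2 with hw
  have hzw : (x : ℂ) - y + I * ((c k : ℂ) + c l) / 2 = z - w := by rw [hz, hw]; ring
  rw [hzw] at hxy ⊢
  have hzim : z.im = c k / 2 := by simp [hz]
  have hwim : w.im = -(c l / 2) := by simp [hw]
  have hzJ : z ∉ cutSet a b := notMem_cutSet_of_im_ne_zero (by
    rw [hzim]; exact div_ne_zero (h.ne_zero k) two_ne_zero)
  have hwJ : w ∉ cutSet a b := notMem_cutSet_of_im_ne_zero (by
    rw [hwim]; exact neg_ne_zero.2 (div_ne_zero (h.ne_zero l) two_ne_zero))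
  -- The loop lies strictly inside the strip, so both poles z and w are beyond it and have index 0.
  have hside : ∀ (j : Fin N) (u : ℝ), |u| < |c j| / 2 → 0 < c j * (c j / 2 - u) := fun j u hu => by
    have h1 : c j * u ≤ |c j| * |u| := by rw [← abs_mul]; exact le_abs_self _
    have h2 := abs_pos.2 (h.ne_zero j)
    nlinarith [abs_mul_abs_self (c j)]
  have hzside : ∀ t ∈ Icc (0 : ℝ) 1, 0 < c k * (z.im - (Γ t).im) := fun t ht => by
    rw [hzim]; exact hside k _ (h.small t ht k)
  have hwside : ∀ t ∈ Icc (0 : ℝ) 1, 0 < (-c l) * (w.im - (Γ t).im) := fun t ht => by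
    have := hside l (-(Γ t).im) (by rw [abs_neg]; exact h.small t ht l)
    rw [hwim]; linarith
  have hzne : ∀ t ∈ Icc (0 : ℝ) 1, Γ t - z ≠ 0 := fun t ht h0 => by
    have := hzside t ht
    rw [sub_eq_zero.1 h0] at this
    simp at this
  have hwne : ∀ t ∈ Icc (0 : ℝ) 1, Γ t - w ≠ 0 := fun t ht h0 => by
    have := hwside t ht
    rw [sub_eq_zero.1 h0] at this
    simp at this
  have hi : ∀ {p : ℂ}, (∀ t ∈ Icc (0 : ℝ) 1, Γ t - p ≠ 0) → ∀ m, IntervalIntegrable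
      (fun t => (χ (Γ t))⁻¹ (v k) m / (Γ t - p) * deriv Γ t) volume 0 1 := fun {p} hp m =>
    h.loop.piecewiseC1.intervalIntegrable_mul_deriv
      (f := fun ζ => (χ ζ)⁻¹ (v k) m / (ζ - p)) (U := (cutSet a b)ᶜ ∩ {ζ | ζ - p ≠ 0})
      (((h.holomorphic_inv (v k) m).continuousOn.mono inter_subset_left).div (by fun_prop)
        fun ζ hζ => hζ.2) fun t ht => ⟨h.loop.avoids t ht, hp t ht⟩
  have hpt : ∀ t ∈ Icc (0 : ℝ) 1, factorB c Γ k x t * factorA χ c γ v Γ k l t y =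
      (Real.sign (c k) / (2 * I * Real.pi) * (γ k / (2 * I * Real.pi)) / (z - w)) *
        ∑ m, χ w m l * ((χ (Γ t))⁻¹ (v k) m / (Γ t - z) * deriv Γ t -
          (χ (Γ t))⁻¹ (v k) m / (Γ t - w) * deriv Γ t) := fun t ht => by
    have e1 : (x : ℂ) - (Γ t - I * c k / 2) = -(Γ t - z) := by rw [hz]; ring
    have e2 : (y : ℂ) - (Γ t + I * c l / 2) = -(Γ t - w) := by rw [hw]; ring
    have e4 : (y : ℂ) + -(I * c l / 2) = w := by rw [hw]; ring
    have n1 := hzne t ht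
    have n2 := hwne t ht
    have e3 : ∀ m, χ w m l * ((χ (Γ t))⁻¹ (v k) m / (Γ t - z) * deriv Γ t -
          (χ (Γ t))⁻¹ (v k) m / (Γ t - w) * deriv Γ t) =
        ((χ (Γ t))⁻¹ (v k) m * χ w m l) *
          (deriv Γ t * (z - w) * ((Γ t - z)⁻¹ * (Γ t - w)⁻¹)) := fun m => by
      field_simp; ring
    simp only [e3]
    rw [← Finset.sum_mul, factorA, factorB, extendCurve_of_mem ht, extendSpeed_of_mem ht, e1, e2,
      e4, inv_neg, inv_neg]
    field_simp
  have e5 : ∀ m, ∫ t in (0 : ℝ)..1, ((χ (Γ t))⁻¹ (v k) m / (Γ t - z) * deriv Γ t -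
      (χ (Γ t))⁻¹ (v k) m / (Γ t - w) * deriv Γ t) =
      2 * Real.pi * I * ((χ w)⁻¹ (v k) m - (χ z)⁻¹ (v k) m) := fun m => by
    rw [intervalIntegral.integral_sub (hi hzne m) (hi hwne m),
      h.loop.integral_div_sub h.lt (h.holomorphic_inv (v k) m) (h.infinity_inv (v k) m) hzJ hzside,
      h.loop.integral_div_sub h.lt (h.holomorphic_inv (v k) m) (h.infinity_inv (v k) m) hwJ hwside]
    ring
  rw [kernelBA, setIntegral_congr_fun measurableSet_Icc hpt, integral_const_mul,
    integral_Icc_eq_integral_Ioc, ← intervalIntegral.integral_of_le zero_le_one,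
    intervalIntegral.integral_finsetSum fun m _ => ((hi hzne m).sub (hi hwne m)).const_mul _]
  simp only [intervalIntegral.integral_const_mul, e5]
  -- The values at infinity have cancelled between the two poles, and χ⁻¹(w)χ(w) = I produces the
  -- identity matrix in N.
  have hM : ∑ m, χ w m l * (2 * Real.pi * I * ((χ w)⁻¹ (v k) m - (χ z)⁻¹ (v k) m)) =
      2 * Real.pi * I * (1 - (χ z)⁻¹ * χ w) (v k) l := by
    rw [← h.inv_mul w hwJ, ← sub_mul, Matrix.mul_apply, Finset.mul_sum]
    exact Finset.sum_congr rfl fun m _ => by rw [Matrix.sub_apply]; ring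
  have hpi : (Real.pi : ℂ) ≠ 0 := by exact_mod_cast Real.pi_ne_zero
  rw [hM]
  field_simp

theorem kernelBA_eq (h : LoopData a b χ c Γ) (γ : Fin N → ℂ) (v : Fin N → Fin N)
    (k l : Fin N) (x y : ℝ) :
    kernelBA (volume.restrict (Icc (0 : ℝ) 1)) (factorA χ c γ v Γ) (factorB c Γ) k l x y =
      kernelN χ c γ v k l x y := by
  unfold kernelN
  split_ifs with hxy
  · have hre : x = y := by
      have := congrArg Complex.re hxy
      simp at this
      linarith
    have him : c k + c l = 0 := by
      have := congrArg Complex.im hxy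
      simpa using this
    subst hre
    have hcc : (c k : ℂ) + c l = 0 := by exact_mod_cast him
    set z : ℂ := x + I * c k / 2 with hz
    have hzJ : z ∉ cutSet a b := notMem_cutSet_of_im_ne_zero (by
      simpa [hz] using h.ne_zero k)
    have hshift : ∀ y : ℝ, (y : ℂ) - I * c l / 2 = y + (z - x) := fun y => by
      rw [hz]; linear_combination (-I / 2) * hcc
    have hlim1 : Tendsto (fun y => kernelBA (volume.restrict (Icc (0 : ℝ) 1))
        (factorA χ c γ v Γ) (factorB c Γ) k l x y) (𝓝[≠] x) (𝓝 (kernelBA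
        (volume.restrict (Icc (0 : ℝ) 1)) (factorA χ c γ v Γ) (factorB c Γ) k l x x)) :=
      (((h.continuous_kernelBA γ v k l).comp (by fun_prop : Continuous fun y : ℝ => (x, y))).tendsto
        x).mono_left nhdsWithin_le_nhds
    -- The degenerate value is the limit as y → x with y ≠ x of the residue formula, where I -
    -- χ⁻¹(z)χ(w) = χ⁻¹(z)(χ(z) - χ(w)) turns the quotient into χ⁻¹(z) times a slope of χ.
    refine tendsto_nhds_unique hlim1 ?_
    have hder : ∀ m, HasDerivAt (fun y : ℝ => χ (y + (z - x)) m l)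
        (deriv (fun ζ => χ ζ m l) z) x := fun m => by
      have h1 : HasDerivAt (fun ζ => χ ζ m l) (deriv (fun ζ => χ ζ m l) z) (x + (z - x)) := by
        rw [add_sub_cancel]
        exact ((h.holomorphic m l).differentiableAt
          ((isOpen_cutSet_compl a b).mem_nhds hzJ)).hasDerivAt
      have h2 : HasDerivAt (fun y : ℝ => (y : ℂ) + (z - x)) 1 x :=
        ((hasDerivAt_id (x : ℂ)).add_const (z - x)).comp_ofReal
      have h3 := h1.comp x h2
      rwa [mul_one] at h3
    have hlim2 : Tendsto (fun y => Real.sign (c k) * γ k *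
        (∑ m, (χ z)⁻¹ (v k) m * slope (fun y : ℝ => χ (y + (z - x)) m l) x y) /
        (2 * I * (Real.pi : ℂ))) (𝓝[≠] x) (𝓝 (Real.sign (c k) * γ k *
        (∑ m, (χ z)⁻¹ (v k) m * deriv (fun ζ => χ ζ m l) z) / (2 * I * (Real.pi : ℂ)))) :=
      ((tendsto_finsetSum _ fun m _ =>
        ((hasDerivAt_iff_tendsto_slope.1 (hder m)).const_mul _)).const_mul _).div_const _
    rw [Matrix.mul_apply]
    refine hlim2.congr' ?_
    filter_upwards [self_mem_nhdsWithin] with y hy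
    have hyx : (x : ℂ) - y ≠ 0 := sub_ne_zero.2 (by exact_mod_cast Ne.symm hy)
    have hyx' : (y : ℂ) - x ≠ 0 := sub_ne_zero.2 (by exact_mod_cast hy)
    have hden : (x : ℂ) - y + I * ((c k : ℂ) + c l) / 2 = x - y := by
      rw [hcc]; simp
    rw [h.kernelBA_of_ne γ v k l (by rwa [hden]), hden, ← hz, hshift]
    have hsum : ∑ m, (χ z)⁻¹ (v k) m * slope (fun y : ℝ => χ (y + (z - x)) m l) x y =
        (1 - (χ z)⁻¹ * χ (y + (z - x))) (v k) l / (x - y) := by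
      rw [eq_div_iff hyx, Finset.sum_mul]
      conv_rhs => rw [← h.inv_mul z hzJ, ← mul_sub, Matrix.mul_apply]
      refine Finset.sum_congr rfl fun m _ => ?_
      rw [slope_def_module, Matrix.sub_apply, add_sub_cancel, Complex.real_smul]
      push_cast
      field_simp
      ring
    rw [hsum]
    field_simp
  · exact h.kernelBA_of_ne γ v k l hxy

end LoopData

end Factors

end

/-! ### Conclusion. -/

theorem mainTheorem4 (N : ℕ) (a b : ℝ) (hab : a < b)
    (EL ER : ℝ → Fin N → ℂ)
    (hEL : ContDiffOn ℝ ∞ EL (Icc a b)) (hER : ContDiffOn ℝ ∞ ER (Icc a b))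
    (hreg : ∀ s ∈ Icc a b, EL s ⬝ᵥ ER s = 0)
    (χ : ℂ → Matrix (Fin N) (Fin N) ℂ) (hχ : IsRHPSolution a b EL ER χ)
    (c : Fin N → ℝ) (hc : ∀ k, c k ≠ 0) (γ : Fin N → ℂ) (v : Fin N → Fin N)
    (Γ : ℝ → ℂ) (hΓ : IsLoopAround a b Γ)
    (hsmall : ∀ t ∈ Icc (0 : ℝ) 1, ∀ k, |(Γ t).im| < |c k| / 2) :
    HasFredholmDet (volume.restrict (Icc (0 : ℝ) 1)) (pullbackKernel Γ (kernelM χ c γ v)) ∧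
    (∀ k l, Continuous fun p : ℝ × ℝ => kernelN χ c γ v k l p.1 p.2) ∧
    HasFredholmDet (volume : Measure ℝ) (kernelN χ c γ v) ∧
    fredholmDet (volume.restrict (Icc (0 : ℝ) 1)) (pullbackKernel Γ (kernelM χ c γ v)) =
      fredholmDet (volume : Measure ℝ) (kernelN χ c γ v) := by
  have h : LoopData a b χ c Γ := ⟨hab, hχ.holomorphic, hχ.infinity,
    hχ.differentiableOn_inv hab hreg, hχ.inv_infinity hab hreg, fun z hz =>
      Matrix.nonsing_inv_mul _ (by rw [hχ.det_eq_one hab hreg hz]; exact isUnit_one),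
    hΓ, hc, hsmall⟩
  obtain ⟨C, -, hF⟩ := h.exists_kernelFactors γ v
  have hN : kernelBA (volume.restrict (Icc (0 : ℝ) 1)) (factorA χ c γ v Γ) (factorB c Γ) =
      kernelN χ c γ v := by
    funext k l x y
    exact h.kernelBA_eq γ v k l x y
  obtain ⟨hM, hMdet⟩ := hF.hasFredholmDet_kernelAB.congr_restrict measurableSet_Icc
    fun k l s hs t ht => h.kernelAB_eq γ v k l hs ht
  refine ⟨hM, fun k l => ?_, hN ▸ hF.hasFredholmDet_kernelBA, ?_⟩
  · rw [← hN]
    exact h.continuous_kernelBA γ v k l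
  · rw [← hMdet, hF.fredholmDet_kernelAB_eq, hN]
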